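/- Let $\kappa\ge 2$ be an integer and let $Q(f)=-f^{\kappa}+\sum_{\alpha=0}^{\kappa-1}a_\alpha f^{\alpha}$ be a real polynomial with $\kappa$ simple real roots $q^{\kappa}<q^{\kappa-1}<\cdots<q^{1}$. (The superscripts of $q$, $p$, $T$, $h$, $\mathcal H$ are indices.) Consider the planar system $x'(s)=iQ(x(s))$, $x\in\mathbb C$, on the Poincaré hemisphere $\mathbb H^2=\{(U,w)\in\mathbb C\times\mathbb R: |U|^2+w^2=1,\ w\ge 0\}$, where $x\in\mathbb C$ corresponds to $(U,w)=(x,1)/\sqrt{1+|x|^2}$ and the equator $w=0$ represents $x=\infty$. For $j\in\{1,\ldots,\kappa-1\}$ let $h^j=(e^{i\theta_j},0)$ with $\theta_j=\frac{\pi}{\kappa-1}(j-1)+\frac{\pi}{2(\kappa-1)}$, a saddle on the equator, and let $\mathcal H^j\subset\mathbb C$ be its stable manifold if $j$ is odd and its unstable manifold if $j$ is even, without $h^j$; that is, $\mathcal H^j$ is the set of those $z\in\mathbb C$ whose trajectory converges on $\mathbb H^2$ to $h^j$ in forward time ($j$ odd), respectively backward time ($j$ even). Then $$\sum_{l=1}^{\kappa}\frac{1}{Q'(q^l)}=0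 .$$ Moreover, for every $j\in\{1,\ldots,\kappa-1\}$, $\mathcal H^j$ meets the real axis in exactly one point $p^j$, the solution of $x'(s)=iQ(x(s))$, $x(0)=p^j$, $s\ge 0$, blows up at a finite time $T^j\in(0,\infty)$ (i.e. it exists on $[0,T^j)$ and $|x(s)|\to\infty$ as $s\to T^j$ from below), and $$\sum_{l=1}^{j}\frac{1}{Q'(q^l)}=\frac{(-1)^j\,T^j}{\pi}.$$ -/

import Mathlib

open Polynomial Filter Topology

noncomputable section

/-- The real polynomial `Q(f) = -f^κ + ∑_{α < κ} a_α f^α`. -/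
def polyQ (κ : ℕ) (a : ℕ → ℝ) : ℝ[X] :=
  -X ^ κ + ∑ α ∈ Finset.range κ, C (a α) * X ^ α

/-- The numbers `q 1 > q 2 > ⋯ > q κ` are simple real roots of `Q`. -/
structure HasOrderedSimpleRoots (κ : ℕ) (Q : ℝ[X]) (q : ℕ → ℝ) : Prop where
  anti : StrictAntiOn q (Set.Icc 1 κ)
  root : ∀ j ∈ Set.Icc 1 κ, Q.eval (q j) = 0
  simple : ∀ j ∈ Set.Icc 1 κ, Q.derivative.eval (q j) ≠ 0

/-- The vector field `x ↦ i Q(x)` on `ℂ`. -/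
def imagField (Q : ℝ[X]) (x : ℂ) : ℂ := Complex.I * aeval x Q

/-- The time interval `[0, ω)`, where `ω` may be `∞`. -/
def forwardInterval (ω : EReal) : Set ℝ := {s | 0 ≤ s ∧ (s : EReal) < ω}

/-- `x` solves `x' = f(x)`, `x(0) = z`, on `[0, ω)` with `0 < ω ≤ ∞`. -/
structure IsForwardSolution (f : ℂ → ℂ) (z : ℂ) (ω : EReal) (x : ℝ → ℂ) : Prop where
  pos : 0 < ω
  init : x 0 = z
  deriv : ∀ s ∈ forwardInterval ω, HasDerivWithinAt x (f (x s)) (forwardInterval ω) s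

/-- The embedding of the plane `ℂ` as the open upper hemisphere of the unit sphere in
`ℂ × ℝ = ℝ³`: the point `(U, w)` with `|U|² + w² = 1`, `w > 0` and `x = U / w`. -/
def poincareEmbedding (x : ℂ) : ℂ × ℝ :=
  ((((Real.sqrt (1 + ‖x‖ ^ 2))⁻¹ : ℝ) : ℂ) * x, (Real.sqrt (1 + ‖x‖ ^ 2))⁻¹)

/-- The point of the equator (the circle at infinity) with angle
`(π / (κ - 1)) (l - 1) + π / (2 (κ - 1))`. -/
def equatorSaddle (κ l : ℕ) : ℂ × ℝ :=
  (Complex.exp (Complex.I *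
    ((Real.pi / ((κ : ℝ) - 1) * ((l : ℝ) - 1) + Real.pi / (2 * ((κ : ℝ) - 1)) : ℝ) : ℂ)), 0)

/-- The finite part of the stable manifold of a point `h` of the closed hemisphere: all `z ∈ ℂ`
whose forward trajectory under `x' = f(x)`, seen on the hemisphere, converges to `h`. The
trajectory is followed in the original time, up to a time `ω` which may be finite or infinite
(the notion only depends on orbits, hence not on the way time is parametrised). -/
def stableManifold (f : ℂ → ℂ) (h : ℂ × ℝ) : Set ℂ :=
  {z | ∃ (ω : EReal) (x : ℝ → ℂ), IsForwardSolution f z ω x ∧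
    Tendsto (fun s => poincareEmbedding (x s))
      (comap (fun s : ℝ => (s : EReal)) (𝓝[<] ω)) (𝓝 h)}

/-- The finite part of the unstable manifold: the stable manifold for reversed time. -/
def unstableManifold (f : ℂ → ℂ) (h : ℂ × ℝ) : Set ℂ :=
  stableManifold (fun x => -f x) h

/-- The trajectory `ℋ^j` of `x' = i Q(x)`: the stable (`j` odd) or unstable (`j` even) manifold
of the equilibrium `equatorSaddle κ j` at infinity, without the equilibrium itself. -/
def trajH (κ : ℕ) (Q : ℝ[X]) (j : ℕ) : Set ℂ :=
  if Odd j then stableManifold (imagField Q) (equatorSaddle κ j)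
  else unstableManifold (imagField Q) (equatorSaddle κ j)

/-- The solution of `x' = f(x)`, `x(0) = z`, `s ≥ 0`, blows up at the finite time `T`. -/
def IsBlowupTime (f : ℂ → ℂ) (z : ℂ) (T : ℝ) : Prop :=
  ∃ x : ℝ → ℂ, IsForwardSolution f z (T : EReal) x ∧
    Tendsto (fun s => ‖x s‖) (𝓝[<] T) atTop

end

noncomputable section

/-! ### Divided differences of step functions -/

section DividedDifference

variable {ι : Type*} [DecidableEq ι] {v : ι → ℝ} {s : Finset ι}

/-! Write `Q = -∏ (x - q l)`, let `r l` be the residue of `1/Q` at `q l`, `S m` the sum of the first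
`m` residues, and `F = ∑ r l * log (x - q l)`, so that `F' = 1/Q`. Along `x' = iQ(x)` the value of
`F` moves with velocity `i`: `Re F` is conserved and `Im F` measures time. Since the residues sum to
zero, `F` tends to 0 at infinity in the upper half plane. On the real interval between `q (j+1)` and
`q j` one has `Im F = π * S j`, and `Re F` has exactly one zero `p` there. A trajectory joining `p`
to infinity therefore takes time `π |S j|`, which is the claimed identity once the sign `(-1)^j` of
`S j` is known (`residueSum_pos`).

That such a trajectory exists and ends at the right saddle rests on `im_rootProd_mul_potential_neg`:
`Im (Q F) < 0` in the upper half plane. Hence `log F` has a holomorphic branch (`logPotential`)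
whose derivative `1/(QF)` has positive imaginary part. By the Noshiro–Warschawski argument `arg F`
is strictly increasing along horizontal lines, so the level set `arg F = levelArg j` is a graph over
the height; `|F|` decreases along it from `|F(p)|` to 0. Reparametrized by `|F|` this curve solves
the equation (`exists_trajectory`), and the asymptotics of `arg F` at infinity give its limiting
angle.

For uniqueness, any trajectory escaping to infinity has `Re F = 0`. A real starting point is then
the zero in some bounded interval, say the `m`-th, and the orbit already constructed through it, or
its complex conjugate, identifies the limit and forces `m = j` (`inCell_of_mem_stableManifold`). -/

theorem nodalWeight_insert_of_mem {i l : ι} (hi : i ∉ s) (hl : l ∈ s) :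
    Lagrange.nodalWeight (insert i s) v l = (v l - v i)⁻¹ * Lagrange.nodalWeight s v l := by
  have h : (insert i s).erase l = insert i (s.erase l) :=
    Finset.erase_insert_of_ne (fun h => hi (h ▸ hl))
  rw [Lagrange.nodalWeight, h, Finset.prod_insert (fun h => hi (Finset.mem_of_mem_erase h)),
    Lagrange.nodalWeight]

theorem nodalWeight_insert_self {i : ι} (hi : i ∉ s) :
    Lagrange.nodalWeight (insert i s) v i = ∏ k ∈ s, (v i - v k)⁻¹ := by
  rw [Lagrange.nodalWeight, Finset.erase_insert hi]

/-- The recurrence for divided differences. -/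
theorem sum_nodalWeight_insert_insert {i j : ι} (hi : i ∉ s) (hj : j ∉ s)
    (hv : Set.InjOn v (insert i (insert j s) : Finset ι)) (hij : i ≠ j) (f : ι → ℝ) :
    (v i - v j) * ∑ l ∈ insert i (insert j s),
        f l * Lagrange.nodalWeight (insert i (insert j s)) v l
      = ∑ l ∈ insert i s, f l * Lagrange.nodalWeight (insert i s) v l
        - ∑ l ∈ insert j s, f l * Lagrange.nodalWeight (insert j s) v l := by
  have hi' : i ∉ insert j s := by simp [hij, hi]
  have hj' : j ∉ insert i s := by simp [hij.symm, hj]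
  have hvij : v i - v j ≠ 0 := sub_ne_zero.2 fun h => hij (hv (by simp) (by simp) h)
  have h1 : Lagrange.nodalWeight (insert i (insert j s)) v i
      = (v i - v j)⁻¹ * Lagrange.nodalWeight (insert i s) v i := by
    rw [nodalWeight_insert_self hi', Finset.prod_insert hj, nodalWeight_insert_self hi]
  have h2 : Lagrange.nodalWeight (insert i (insert j s)) v j
      = (v j - v i)⁻¹ * Lagrange.nodalWeight (insert j s) v j := by
    rw [nodalWeight_insert_of_mem hi' (by simp)]
  have h3 : ∀ l ∈ s, (v i - v j) *
      (f l * Lagrange.nodalWeight (insert i (insert j s)) v l)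
      = f l * Lagrange.nodalWeight (insert i s) v l
        - f l * Lagrange.nodalWeight (insert j s) v l := by
    intro l hl
    rw [nodalWeight_insert_of_mem hi' (by simp [hl]), nodalWeight_insert_of_mem hj hl,
      nodalWeight_insert_of_mem hi hl]
    have a1 : v l - v i ≠ 0 := sub_ne_zero.2 fun h => hi (hv (by simp [hl]) (by simp) h ▸ hl)
    have a2 : v l - v j ≠ 0 := sub_ne_zero.2 fun h => hj (hv (by simp [hl]) (by simp) h ▸ hl)
    field_simp
    ring
  rw [Finset.sum_insert hi', Finset.sum_insert hj, Finset.sum_insert hi, Finset.sum_insert hj,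
    h1, h2, mul_add, mul_add, Finset.mul_sum, Finset.sum_congr rfl h3, Finset.sum_sub_distrib]
  have hvji : v j - v i ≠ 0 := by rw [← neg_sub]; exact neg_ne_zero.2 hvij
  have e1 : (v i - v j) * (f i * ((v i - v j)⁻¹ * Lagrange.nodalWeight (insert i s) v i))
      = f i * Lagrange.nodalWeight (insert i s) v i := by field_simp
  have e2 : (v i - v j) * (f j * ((v j - v i)⁻¹ * Lagrange.nodalWeight (insert j s) v j))
      = - (f j * Lagrange.nodalWeight (insert j s) v j) := by
    rw [← neg_sub (v j) (v i)]; field_simp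
  rw [e1, e2]
  ring

/-- Compare top coefficients in Lagrange interpolation; all moment identities for the residues come
from here. -/
theorem sum_eval_mul_nodalWeight (hv : Set.InjOn v s) {P : ℝ[X]} (hP : P.degree < s.card) :
    ∑ l ∈ s, P.eval (v l) * Lagrange.nodalWeight s v l = P.coeff (s.card - 1) := by
  rw [Lagrange.coeff_eq_sum hv hP]
  refine Finset.sum_congr rfl fun l _ => ?_
  rw [Lagrange.nodalWeight, Finset.prod_inv_distrib, div_eq_mul_inv]

theorem sum_pow_mul_nodalWeight (hv : Set.InjOn v s) {n : ℕ} (hn : n < s.card) :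
    ∑ l ∈ s, v l ^ n * Lagrange.nodalWeight s v l = if n = s.card - 1 then 1 else 0 := by
  have := sum_eval_mul_nodalWeight hv (P := X ^ n) (by rw [degree_X_pow]; exact_mod_cast hn)
  simpa [coeff_X_pow, eq_comm] using this

end DividedDifference

/-- The divided difference of the indicator of `l ≤ m` over the nodes `q a, …, q (a + n)`. -/
def stepDiff (q : ℕ → ℝ) (a n m : ℕ) : ℝ :=
  ∑ l ∈ Finset.Icc a (a + n), (if l ≤ m then 1 else 0) *
    Lagrange.nodalWeight (Finset.Icc a (a + n)) q l

theorem stepDiff_of_lt (q : ℕ → ℝ) {a n m : ℕ} (h : m < a) : stepDiff q a n m = 0 := by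
  refine Finset.sum_eq_zero fun l hl => ?_
  rw [if_neg (by have := (Finset.mem_Icc.1 hl).1; omega), zero_mul]

theorem stepDiff_of_le {q : ℕ → ℝ} {a n m : ℕ} (hq : Set.InjOn q (Set.Icc a (a + n)))
    (h : a + n ≤ m) : stepDiff q a n m = if n = 0 then 1 else 0 := by
  have hc : (Finset.Icc a (a + n)).card = n + 1 := by simp; omega
  have := sum_pow_mul_nodalWeight (s := Finset.Icc a (a + n)) (v := q) (n := 0)
    (by simpa using hq) (by omega)
  rw [hc] at this
  rw [stepDiff]
  convert this using 1
  · refine Finset.sum_congr rfl fun l hl => ?_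
    rw [if_pos (by have := (Finset.mem_Icc.1 hl).2; omega), pow_zero]
  · simp [eq_comm]

theorem stepDiff_succ {q : ℕ → ℝ} {a n m : ℕ} (hq : Set.InjOn q (Set.Icc a (a + (n + 1)))) :
    (q a - q (a + (n + 1))) * stepDiff q a (n + 1) m
      = stepDiff q a n m - stepDiff q (a + 1) n m := by
  have e0 : Finset.Icc a (a + (n + 1))
      = insert a (insert (a + (n + 1)) (Finset.Icc (a + 1) (a + n))) := by
    ext l; simp only [Finset.mem_insert, Finset.mem_Icc]; omega
  have e1 : Finset.Icc a (a + n) = insert a (Finset.Icc (a + 1) (a + n)) := by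
    ext l; simp only [Finset.mem_insert, Finset.mem_Icc]; omega
  have e2 : Finset.Icc (a + 1) (a + 1 + n)
      = insert (a + (n + 1)) (Finset.Icc (a + 1) (a + n)) := by
    ext l; simp only [Finset.mem_insert, Finset.mem_Icc]; omega
  rw [stepDiff, stepDiff, stepDiff, e0, e1, e2]
  refine sum_nodalWeight_insert_insert (by simp) (by simp) ?_ (by omega) _
  rw [← e0]
  simpa using hq

/-- In the recurrence the step differences over the first and over the last nodes have opposite
signs by induction, so their difference cannot cancel. Either may vanish, when its nodes lie on one
side of the step, but not both. -/
theorem stepDiff_pos {q : ℕ → ℝ} (n : ℕ) : ∀ a m : ℕ, StrictAntiOn q (Set.Icc a (a + n)) →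
    a ≤ m → m < a + n → 0 < (-1) ^ (m + a) * stepDiff q a n m := by
  induction n with
  | zero => intro a m _ h1 h2; omega
  | succ n ih =>
    intro a m hq h1 h2
    have hpos : 0 < q a - q (a + (n + 1)) :=
      sub_pos.2 (hq ⟨le_rfl, by omega⟩ ⟨by omega, le_rfl⟩ (by omega))
    have hrec := stepDiff_succ (m := m) hq.injOn
    have hqa : StrictAntiOn q (Set.Icc a (a + n)) := hq.mono (Set.Icc_subset_Icc_right (by omega))
    have hqb : StrictAntiOn q (Set.Icc (a + 1) (a + 1 + n)) :=
      hq.mono (Set.Icc_subset_Icc (by omega) (by omega))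
    have hA : 0 ≤ (-1) ^ (m + a) * stepDiff q a n m ∧
        (m < a + n ∨ n = 0 → 0 < (-1) ^ (m + a) * stepDiff q a n m) := by
      rcases lt_or_ge m (a + n) with h | h
      · have := ih a m hqa h1 h
        exact ⟨this.le, fun _ => this⟩
      · rw [stepDiff_of_le hqa.injOn h]
        split_ifs with h0
        · have : m = a := by omega
          subst this
          simp [← two_mul]
        · simp only [mul_zero, le_refl, true_and, lt_irrefl]
          omega
    have hB : 0 ≤ - ((-1) ^ (m + a) * stepDiff q (a + 1) n m) ∧
        (a + 1 ≤ m → 0 < - ((-1) ^ (m + a) * stepDiff q (a + 1) n m)) := by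
      rcases lt_or_ge m (a + 1) with h | h
      · rw [stepDiff_of_lt q h]
        simp only [mul_zero, neg_zero, le_refl, true_and, lt_irrefl]
        omega
      · have := ih (a + 1) m hqb h (by omega)
        have e : (-1 : ℝ) ^ (m + (a + 1)) * stepDiff q (a + 1) n m
          = - ((-1) ^ (m + a) * stepDiff q (a + 1) n m) := by ring
        rw [e] at this
        exact ⟨this.le, fun _ => this⟩
    have hkey : 0 < (q a - q (a + (n + 1))) * ((-1) ^ (m + a) * stepDiff q a (n + 1) m) := by
      have e : (q a - q (a + (n + 1))) * ((-1) ^ (m + a) * stepDiff q a (n + 1) m)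
          = (-1) ^ (m + a) * stepDiff q a n m
            + - ((-1) ^ (m + a) * stepDiff q (a + 1) n m) := by
        linear_combination (-1 : ℝ) ^ (m + a) * hrec
      rw [e]
      by_cases h : a + 1 ≤ m
      · exact add_pos_of_nonneg_of_pos hA.1 (hB.2 h)
      · exact add_pos_of_pos_of_nonneg (hA.2 (by omega)) hB.1
    exact pos_of_mul_pos_right hkey hpos.le

/-! ### The residues `1 / Q'(q l)` -/

/-- The residue of `1 / Q` at `q l`, where `Q = -∏ (X - q l)`. -/
def residueAt (κ : ℕ) (q : ℕ → ℝ) (l : ℕ) : ℝ :=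
  -Lagrange.nodalWeight (Finset.Icc 1 κ) q l

/-- The sum of the residues at the `m` largest roots. -/
def residueSum (κ : ℕ) (q : ℕ → ℝ) (m : ℕ) : ℝ := ∑ l ∈ Finset.Icc 1 m, residueAt κ q l

section Residues

variable {κ : ℕ} {q : ℕ → ℝ}

/-- The vanishing moments make the potential decay at infinity and let polynomial corrections be
subtracted for free; the last one supplies its leading coefficient there. -/
theorem sum_residueAt_mul_pow (hq : StrictAntiOn q (Set.Icc 1 κ)) {n : ℕ} (hn : n < κ) :
    ∑ l ∈ Finset.Icc 1 κ, residueAt κ q l * q l ^ n = if n = κ - 1 then -1 else 0 := by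
  have := sum_pow_mul_nodalWeight (s := Finset.Icc 1 κ) (v := q) (n := n)
    (by simpa using hq.injOn) (by simpa using hn)
  rw [Nat.card_Icc, Nat.add_sub_cancel] at this
  rw [← neg_inj, ← Finset.sum_neg_distrib]
  convert this using 1
  · exact Finset.sum_congr rfl fun l _ => by rw [residueAt]; ring
  · split_ifs <;> simp

theorem residueSum_self (hκ : 2 ≤ κ) (hq : StrictAntiOn q (Set.Icc 1 κ)) :
    residueSum κ q κ = 0 := by
  have := sum_residueAt_mul_pow hq (n := 0) (by omega)
  rw [if_neg (by omega)] at this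
  simpa [residueSum] using this

/-- Up to sign, this partial sum is the divided difference over all roots of the indicator of the
first `m`. -/
theorem residueSum_pos (hq : StrictAntiOn q (Set.Icc 1 κ)) {m : ℕ} (h1 : 1 ≤ m) (h2 : m < κ) :
    0 < (-1) ^ m * residueSum κ q m := by
  obtain ⟨n, rfl⟩ : ∃ n, κ = 1 + n := ⟨κ - 1, by omega⟩
  have := stepDiff_pos n 1 m hq h1 h2
  have e : stepDiff q 1 n m = - residueSum (1 + n) q m := by
    rw [stepDiff, residueSum, ← Finset.sum_neg_distrib]
    simp only [ite_mul, one_mul, zero_mul]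
    rw [← Finset.sum_filter]
    refine Finset.sum_congr ?_ fun l _ => by rw [residueAt, neg_neg]
    ext l
    simp only [Finset.mem_filter, Finset.mem_Icc]
    omega
  rw [e] at this
  rw [pow_succ] at this
  linarith

theorem polyQ_eq_neg_nodal {a : ℕ → ℝ} (hq : HasOrderedSimpleRoots κ (polyQ κ a) q) :
    polyQ κ a = -Lagrange.nodal (Finset.Icc 1 κ) q := by
  have hc : (Finset.Icc 1 κ).card = κ := by simp
  have hdeg : (∑ α ∈ Finset.range κ, C (a α) * X ^ α).degree < (κ : WithBot ℕ) := by
    refine (degree_sum_le _ _).trans_lt ?_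
    refine (Finset.sup_lt_iff (WithBot.bot_lt_coe κ)).2 fun α hα => ?_
    exact (degree_C_mul_X_pow_le _ _).trans_lt (WithBot.coe_lt_coe.2 (Finset.mem_range.1 hα))
  have hnd : (Lagrange.nodal (Finset.Icc 1 κ) q - X ^ κ).degree < (κ : WithBot ℕ) := by
    have h1 : (Lagrange.nodal (Finset.Icc 1 κ) q).degree = (κ : WithBot ℕ) := by
      rw [Lagrange.degree_nodal, hc]
    have h2 := degree_sub_lt_left (p := Lagrange.nodal (Finset.Icc 1 κ) q) (q := X ^ κ)
      (by rw [h1, degree_X_pow]) Lagrange.nodal_ne_zero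
      (by rw [Lagrange.nodal_monic.leadingCoeff, (monic_X_pow κ).leadingCoeff])
    rwa [h1] at h2
  have hinj : Set.InjOn q (Finset.Icc 1 κ : Finset ℕ) := by simpa using hq.anti.injOn
  refine Polynomial.eq_of_degree_sub_lt_of_eval_index_eq _ hinj ?_ ?_
  · rw [hc, polyQ]
    have e : -X ^ κ + ∑ α ∈ Finset.range κ, C (a α) * X ^ α - -Lagrange.nodal (Finset.Icc 1 κ) q
      = ∑ α ∈ Finset.range κ, C (a α) * X ^ α + (Lagrange.nodal (Finset.Icc 1 κ) q - X ^ κ) := by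
      ring
    rw [e]
    exact (degree_add_le _ _).trans_lt (max_lt hdeg hnd)
  · intro i hi
    rw [hq.root i (by simpa using hi), eval_neg, Lagrange.eval_nodal_at_node hi, neg_zero]

theorem one_div_derivative_polyQ {a : ℕ → ℝ}
    (hq : HasOrderedSimpleRoots κ (polyQ κ a) q) {l : ℕ} (hl : l ∈ Finset.Icc 1 κ) :
    1 / (polyQ κ a).derivative.eval (q l) = residueAt κ q l := by
  rw [polyQ_eq_neg_nodal hq, residueAt, Lagrange.nodalWeight_eq_eval_derivative_nodal hl,
    derivative_neg, eval_neg, one_div, inv_neg]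

end Residues

/-! ### The logarithm with its branch cut pointing downwards -/

/-- The branch of `x ↦ log (x - t)` that is holomorphic off the ray `t - i [0, ∞)` and real for
real `x > t`. -/
def logSub (t : ℝ) (x : ℂ) : ℂ :=
  Complex.log (-Complex.I * (x - t)) + Complex.I * (Real.pi / 2 : ℝ)

section LogSub

variable {t : ℝ} {x : ℂ}

theorem neg_I_mul_re (x : ℂ) : (-Complex.I * x).re = x.im := by simp

theorem neg_I_mul_im (x : ℂ) : (-Complex.I * x).im = -x.re := by simp

theorem neg_I_mul_mem_slitPlane (h : 0 < x.im ∨ x.re ≠ t) :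
    -Complex.I * (x - t) ∈ Complex.slitPlane := by
  rw [Complex.mem_slitPlane_iff, neg_I_mul_re, neg_I_mul_im]
  refine h.imp (by simp) fun h => ?_
  simpa [sub_eq_zero, eq_comm] using h

theorem sub_ofReal_ne_zero (h : 0 < x.im ∨ x.re ≠ t) : x - t ≠ 0 := by
  intro h0
  have := Complex.slitPlane_ne_zero (neg_I_mul_mem_slitPlane h)
  simp [h0] at this

theorem hasDerivAt_logSub (h : 0 < x.im ∨ x.re ≠ t) :
    HasDerivAt (logSub t) (1 / (x - t)) x := by
  have h1 : HasDerivAt (fun x : ℂ => -Complex.I * (x - t)) (-Complex.I) x := by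
    simpa using ((hasDerivAt_id x).sub_const (t : ℂ)).const_mul (-Complex.I)
  have h2 := (h1.clog (neg_I_mul_mem_slitPlane h)).add_const (Complex.I * (Real.pi / 2 : ℝ))
  refine h2.congr_deriv ?_
  have := sub_ofReal_ne_zero h
  field_simp

theorem hasDerivAt_logSub_param (h : 0 < x.im ∨ x.re ≠ t) :
    HasDerivAt (fun t : ℝ => logSub t x) (-1 / (x - t)) t := by
  have h1 : HasDerivAt (fun t : ℝ => -Complex.I * (x - t)) (Complex.I) t := by
    simpa using ((Complex.ofRealCLM.hasDerivAt (x := t)).const_sub x).const_mul (-Complex.I)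
  have h2 := (h1.clog_real (neg_I_mul_mem_slitPlane h)).add_const
    (Complex.I * (Real.pi / 2 : ℝ))
  refine h2.congr_deriv ?_
  have := sub_ofReal_ne_zero h
  field_simp

theorem exp_logSub (h : x - t ≠ 0) : Complex.exp (logSub t x) = x - t := by
  have e : Complex.I * (Real.pi / 2 : ℝ) = Real.pi / 2 * Complex.I := by push_cast; ring
  rw [logSub, Complex.exp_add, Complex.exp_log (by simpa using h), e,
    Complex.exp_pi_div_two_mul_I]
  linear_combination (-(x - t)) * Complex.I_mul_I

theorem logSub_re (t : ℝ) (x : ℂ) : (logSub t x).re = Real.log ‖x - t‖ := by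
  simp [logSub, Complex.log_re]

theorem logSub_im (t : ℝ) (x : ℂ) :
    (logSub t x).im = Complex.arg (-Complex.I * (x - t)) + Real.pi / 2 := by
  rw [logSub, Complex.add_im, Complex.log_im, Complex.I_mul_im, Complex.ofReal_re]

theorem logSub_im_of_lt (h0 : x.im = 0) (h : t < x.re) : (logSub t x).im = 0 := by
  have e : -Complex.I * (x - t) = ((x.re - t : ℝ) : ℂ) * (-Complex.I) := by
    apply Complex.ext <;> simp [h0]
  rw [logSub_im, e, Complex.arg_real_mul _ (sub_pos.2 h), Complex.arg_neg_I]
  ring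

theorem logSub_im_of_gt (h0 : x.im = 0) (h : x.re < t) : (logSub t x).im = Real.pi := by
  have e : -Complex.I * (x - t) = ((t - x.re : ℝ) : ℂ) * Complex.I := by
    apply Complex.ext <;> simp [h0]
  rw [logSub_im, e, Complex.arg_real_mul _ (sub_pos.2 h), Complex.arg_I]
  ring

/-- An explicit form giving both the range `(0, π)` and the limits along horizontal lines. -/
theorem logSub_im_eq_arctan (h : 0 < x.im) :
    (logSub t x).im = Real.pi / 2 - Real.arctan ((x.re - t) / x.im) := by
  have e : -Complex.I * (x - t) ≠ 0 := Complex.slitPlane_ne_zero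
    (neg_I_mul_mem_slitPlane (Or.inl h))
  have hre : (-Complex.I * (x - t)).re = x.im := by simp
  have him : (-Complex.I * (x - t)).im = -(x.re - t) := by simp
  have h1 : Complex.arg (-Complex.I * (x - t))
      = Real.arctan ((-Complex.I * (x - t)).im / (-Complex.I * (x - t)).re) := by
    rw [← Complex.tan_arg, Real.arctan_tan]
    · exact (abs_lt.1 (Complex.abs_arg_lt_pi_div_two_iff.2 (Or.inl (by rw [hre]; exact h)))).1
    · exact (abs_lt.1 (Complex.abs_arg_lt_pi_div_two_iff.2 (Or.inl (by rw [hre]; exact h)))).2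
  rw [logSub_im, h1, hre, him, neg_div, Real.arctan_neg]
  ring

theorem logSub_im_pos (h : 0 < x.im) : 0 < (logSub t x).im := by
  rw [logSub_im_eq_arctan h]
  linarith [Real.arctan_lt_pi_div_two ((x.re - t) / x.im)]

theorem logSub_im_lt_pi (h : 0 < x.im) : (logSub t x).im < Real.pi := by
  rw [logSub_im_eq_arctan h]
  linarith [Real.neg_pi_div_two_lt_arctan ((x.re - t) / x.im)]

end LogSub

/-! ### The potential of the flow -/

/-- The polynomial `-∏ (x - q l)` as a function on `ℂ`. -/
def rootProd (κ : ℕ) (q : ℕ → ℝ) (x : ℂ) : ℂ := -∏ l ∈ Finset.Icc 1 κ, (x - q l)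

/-- A primitive of `1 / Q`. -/
def potential (κ : ℕ) (q : ℕ → ℝ) (x : ℂ) : ℂ :=
  ∑ l ∈ Finset.Icc 1 κ, (residueAt κ q l : ℂ) * logSub (q l) x

/-- The points that do not lie below a root. -/
def OffCuts (κ : ℕ) (q : ℕ → ℝ) (x : ℂ) : Prop :=
  ∀ l ∈ Finset.Icc 1 κ, 0 < x.im ∨ x.re ≠ q l

theorem sum_by_parts_Icc (c g : ℕ → ℝ) {n : ℕ} (hn : 1 ≤ n) :
    ∑ l ∈ Finset.Icc 1 n, c l * g l
      = ∑ m ∈ Finset.Ico 1 n, (∑ l ∈ Finset.Icc 1 m, c l) * (g m - g (m + 1))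
        + (∑ l ∈ Finset.Icc 1 n, c l) * g n := by
  induction n, hn using Nat.le_induction with
  | base => simp
  | succ n hn ih =>
    rw [Finset.sum_Icc_succ_top (by omega), ih, Finset.sum_Ico_succ_top hn,
      Finset.sum_Icc_succ_top (by omega)]
    ring

theorem exists_coeff_eval_sub {n : ℕ} {p : ℂ[X]} (hp : p.natDegree ≤ n) (x : ℂ) :
    ∃ d : ℕ → ℂ, ∀ t, p.eval x - p.eval t = (x - t) * ∑ i ∈ Finset.range n, d i * t ^ i := by
  obtain ⟨D, hD⟩ : X - C x ∣ p - C (p.eval x) := by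
    rw [dvd_iff_isRoot]; simp
  rcases Nat.eq_zero_or_pos n with rfl | hn
  · refine ⟨0, fun t => ?_⟩
    rw [eq_C_of_natDegree_le_zero hp]; simp
  have hdeg : D.natDegree < n := by
    by_cases h0 : D = 0
    · simpa [h0] using hn
    have h1 : (p - C (p.eval x)).natDegree ≤ n := by
      refine (natDegree_sub_le _ _).trans ?_
      simp [hp]
    rw [hD, (monic_X_sub_C x).natDegree_mul' h0, natDegree_X_sub_C] at h1
    omega
  refine ⟨D.coeff, fun t => ?_⟩
  rw [← eval_eq_sum_range' hdeg]
  have := congrArg (eval t) hD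
  simp only [eval_sub, eval_C, eval_mul, eval_X] at this
  linear_combination -this

section Potential

variable {κ : ℕ} {q : ℕ → ℝ} {x : ℂ}

/-- Only the powers 1 to `κ - 2` of the roots occur, and these moments vanish. -/
theorem sum_residueAt_mul_primitive (hq : StrictAntiOn q (Set.Icc 1 κ)) (e : ℕ → ℂ) :
    ∑ l ∈ Finset.Icc 1 κ, (residueAt κ q l : ℂ) *
      ∑ i ∈ Finset.range (κ - 2), e i * ((q l : ℂ) ^ (i + 1) / (i + 1)) = 0 := by
  simp_rw [Finset.mul_sum]
  rw [Finset.sum_comm]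
  refine Finset.sum_eq_zero fun i hi => ?_
  have hi' := Finset.mem_range.1 hi
  have := sum_residueAt_mul_pow hq (n := i + 1) (by omega)
  rw [if_neg (by omega)] at this
  have h2 : ∑ l ∈ Finset.Icc 1 κ, (residueAt κ q l : ℂ) * (q l : ℂ) ^ (i + 1) = 0 := by
    exact_mod_cast this
  calc _ = (e i / (i + 1)) * ∑ l ∈ Finset.Icc 1 κ, (residueAt κ q l : ℂ) * (q l : ℂ) ^ (i + 1) := by
        rw [Finset.mul_sum]; exact Finset.sum_congr rfl fun l _ => by ring
    _ = 0 := by rw [h2, mul_zero]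

/-- The two extreme roots are split off because, for `t` between them, their factors divided by `x -
t` have a controlled imaginary part. -/
theorem rootProd_eq_mul (hκ : 2 ≤ κ) (x : ℂ) :
    rootProd κ q x = -((x - q 1) * (x - q κ) *
      (Lagrange.nodal (Finset.Icc 2 (κ - 1)) (fun l => (q l : ℂ))).eval x) := by
  have e : Finset.Icc 1 κ = insert 1 (insert κ (Finset.Icc 2 (κ - 1))) := by
    ext l; simp only [Finset.mem_insert, Finset.mem_Icc]; omega
  rw [rootProd, Lagrange.eval_nodal, e, Finset.prod_insert (by simp; omega),
    Finset.prod_insert (by simp; omega)]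
  ring

theorem im_mul_div_pos {a b t : ℝ} (h : 0 < x.im) (hb : b ≤ t) (ha : t ≤ a) :
    0 < ((x - a) * (x - b) / (x - t)).im := by
  have hne : x - t ≠ 0 := sub_ofReal_ne_zero (Or.inl h)
  have e : (x - a) * (x - b) / (x - t)
      = x + ((t - a - b : ℝ) : ℂ) + (((t - a) * (t - b) : ℝ) : ℂ) * (x - t)⁻¹ := by
    field_simp; push_cast; ring
  rw [e, Complex.add_im, Complex.add_im, Complex.ofReal_im, Complex.im_ofReal_mul, Complex.inv_im,
    Complex.sub_im, Complex.ofReal_im, sub_zero, add_zero]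
  have h1 : (t - a) * (t - b) ≤ 0 := mul_nonpos_of_nonpos_of_nonneg (by linarith) (by linarith)
  have h2 : -x.im / Complex.normSq (x - t) ≤ 0 :=
    div_nonpos_of_nonpos_of_nonneg (by linarith) (Complex.normSq_nonneg _)
  linarith [mul_nonneg_of_nonpos_of_nonpos h1 h2]

theorem prod_sub_sign {t : ℝ} {m a b : ℕ} (ham : a ≤ m + 1) (hmb : m ≤ b)
    (h1 : ∀ l ∈ Finset.Icc a m, t < q l) (h2 : ∀ l ∈ Finset.Icc (m + 1) b, q l < t) :
    0 < (-1) ^ (m + 1 - a) * ∏ l ∈ Finset.Icc a b, (t - q l) := by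
  have e : Finset.Icc a b = Finset.Icc a m ∪ Finset.Icc (m + 1) b := by
    ext l; simp only [Finset.mem_union, Finset.mem_Icc]; omega
  have hd : Disjoint (Finset.Icc a m) (Finset.Icc (m + 1) b) := by
    rw [Finset.disjoint_left]; intro l; simp only [Finset.mem_Icc]; omega
  have hc : (-1 : ℝ) ^ (m + 1 - a) = ∏ l ∈ Finset.Icc a m, (-1 : ℝ) := by simp
  rw [e, Finset.prod_union hd, ← mul_assoc, hc, ← Finset.prod_mul_distrib]
  refine mul_pos (Finset.prod_pos fun l hl => ?_) (Finset.prod_pos fun l hl => ?_)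
  · linarith [h1 l hl]
  · linarith [h2 l hl]

/-- Fix `x` and regard `Q(x) log (x - t)` as a function of the node `t`. After a polynomial
correction invisible to the residues, its imaginary part `g` has derivative `P(t) Im (A/(x - t))`,
whose sign between consecutive roots is that of `P`. Summation by parts pairs the increments of `g`
with the `S m`, of the opposite sign. -/
theorem im_rootProd_mul_potential_neg (hκ : 2 ≤ κ) (hq : StrictAntiOn q (Set.Icc 1 κ))
    (h : 0 < x.im) : (rootProd κ q x * potential κ q x).im < 0 := by
  set p : ℂ[X] := Lagrange.nodal (Finset.Icc 2 (κ - 1)) (fun l => (q l : ℂ)) with hp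
  obtain ⟨d, hd⟩ := exists_coeff_eval_sub (n := κ - 2) (p := p)
    (by rw [hp, Lagrange.natDegree_nodal]; simp; omega) x
  set A : ℂ := (x - q 1) * (x - q κ) with hA
  -- A primitive in `t` of `A (p(x) - p(t))/(x - t)`, the polynomial part of `-Q(x)/(x - t) = A
  -- p(x)/(x - t)`.
  set H : ℝ → ℂ := fun t => ∑ i ∈ Finset.range (κ - 2), A * d i * ((t : ℂ) ^ (i + 1) / (i + 1))
    with hH
  set g : ℝ → ℝ := fun t => (rootProd κ q x * logSub t x - H t).im with hg
  set P : ℝ → ℝ := fun t => ∏ l ∈ Finset.Icc 2 (κ - 1), (t - q l) with hP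
  have hPp : ∀ t : ℝ, p.eval (t : ℂ) = (P t : ℂ) := fun t => by
    rw [hp, Lagrange.eval_nodal, hP]; push_cast; rfl
  have hHd : ∀ t : ℝ, HasDerivAt H (∑ i ∈ Finset.range (κ - 2), A * d i * (t : ℂ) ^ i) t := by
    intro t
    refine HasDerivAt.fun_sum fun i _ => HasDerivAt.const_mul _ ?_
    have h1 : HasDerivAt (fun t : ℂ => t ^ (i + 1) / ((i : ℂ) + 1)) ((t : ℂ) ^ i) (t : ℂ) := by
      refine ((hasDerivAt_pow (i + 1) (t : ℂ)).div_const ((i : ℂ) + 1)).congr_deriv ?_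
      have : (i : ℂ) + 1 ≠ 0 := by exact_mod_cast i.succ_ne_zero
      push_cast
      field_simp
    exact h1.comp_ofReal
  have hgd : ∀ t : ℝ, HasDerivAt g (P t * (A / (x - t)).im) t := by
    intro t
    have hne : x - t ≠ 0 := sub_ofReal_ne_zero (Or.inl h)
    have h1 := (((hasDerivAt_logSub_param (t := t) (Or.inl h)).const_mul (rootProd κ q x)).sub
      (hHd t))
    have h2 := Complex.imCLM.hasFDerivAt.comp_hasDerivAt t h1
    refine HasDerivAt.congr_deriv (f := g) h2 ?_
    rw [Complex.imCLM_apply, ← Complex.im_ofReal_mul, rootProd_eq_mul hκ, ← hp, ← hA, ← hPp]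
    congr 1
    simp_rw [mul_assoc]
    rw [← Finset.mul_sum]
    have := hd t
    field_simp
    linear_combination A * this
  have hsum : (rootProd κ q x * potential κ q x).im
      = ∑ l ∈ Finset.Icc 1 κ, residueAt κ q l * g (q l) := by
    have h1 := sum_residueAt_mul_primitive hq (fun i => A * d i)
    have h2 : rootProd κ q x * potential κ q x
        = ∑ l ∈ Finset.Icc 1 κ, (residueAt κ q l : ℂ) *
          (rootProd κ q x * logSub (q l) x - H (q l)) := by
      simp_rw [mul_sub]
      rw [Finset.sum_sub_distrib, h1, sub_zero, potential, Finset.mul_sum]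
      exact Finset.sum_congr rfl fun l _ => by ring
    rw [h2, Complex.im_sum]
    exact Finset.sum_congr rfl fun l _ => by rw [Complex.im_ofReal_mul]
  have hS := residueSum_self hκ hq
  rw [hsum, sum_by_parts_Icc _ _ (by omega)]
  rw [residueSum] at hS
  -- The boundary term of the summation by parts drops out because the residues sum to zero.
  rw [hS, zero_mul, add_zero, ← neg_pos, ← Finset.sum_neg_distrib]
  refine Finset.sum_pos (fun m hm => ?_) ⟨1, by simp; omega⟩
  rw [Finset.mem_Ico] at hm
  have hS' := residueSum_pos hq hm.1 hm.2
  rw [residueSum] at hS'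
  have hlt : q (m + 1) < q m := hq ⟨hm.1, hm.2.le⟩ ⟨by omega, hm.2⟩ (by omega)
  have hmono : StrictMonoOn (fun t => (-1) ^ (m + 1) * g t) (Set.Icc (q (m + 1)) (q m)) := by
    refine strictMonoOn_of_deriv_pos (convex_Icc _ _) ?_ fun t ht => ?_
    · exact fun t _ => ((hgd t).const_mul _).continuousAt.continuousWithinAt
    rw [interior_Icc] at ht
    rw [((hgd t).const_mul _).deriv, ← mul_assoc]
    have hle : ∀ i j, 1 ≤ i → i ≤ j → j ≤ κ → q j ≤ q i := fun i j h1 h2 h3 =>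
      hq.antitoneOn ⟨h1, by omega⟩ ⟨by omega, h3⟩ h2
    refine mul_pos ?_ (im_mul_div_pos h ?_ ?_)
    · have := prod_sub_sign (q := q) (t := t) (m := m) (a := 2) (b := κ - 1) (by omega)
        (by omega) (fun l hl => ?_) (fun l hl => ?_)
      · have e : (-1 : ℝ) ^ (m + 1) = (-1) ^ (m + 1 - 2) := by
          obtain ⟨n, rfl⟩ : ∃ n, m = n + 1 := ⟨m - 1, by omega⟩
          simp [pow_succ]
        rwa [e]
      · rw [Finset.mem_Icc] at hl
        exact ht.2.trans_le (hle _ _ (by omega) (by omega) (by omega))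
      · rw [Finset.mem_Icc] at hl
        exact (hle _ _ (by omega) (by omega) (by omega)).trans_lt ht.1
    · exact (hle _ _ (by omega) (by omega) (by omega)).trans ht.1.le
    · exact ht.2.le.trans (hle _ _ (by omega) (by omega) (by omega))
  have h1 := hmono (Set.left_mem_Icc.2 hlt.le) (Set.right_mem_Icc.2 hlt.le) hlt
  have h2 := mul_pos hS' (sub_pos.2 h1)
  have e : (-1 : ℝ) ^ m * (-1) ^ m = 1 := by rw [← mul_pow]; simp
  rw [pow_succ] at h2
  simp only at h2
  linear_combination h2 - (∑ l ∈ Finset.Icc 1 m, residueAt κ q l) * (g (q m) - g (q (m + 1))) * e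

end Potential

/-! ### The potential on the real intervals and its holomorphic logarithm -/

section Potential

variable {κ : ℕ} {q : ℕ → ℝ} {x : ℂ}

theorem OffCuts.sub_ne_zero (h : OffCuts κ q x) {l : ℕ} (hl : l ∈ Finset.Icc 1 κ) :
    x - q l ≠ 0 := sub_ofReal_ne_zero (h l hl)

theorem rootProd_ne_zero_iff : rootProd κ q x ≠ 0 ↔ ∀ l ∈ Finset.Icc 1 κ, x - q l ≠ 0 := by
  rw [rootProd, neg_ne_zero, Finset.prod_ne_zero_iff]

theorem OffCuts.rootProd_ne_zero (h : OffCuts κ q x) : rootProd κ q x ≠ 0 :=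
  rootProd_ne_zero_iff.2 fun _ hl => h.sub_ne_zero hl

theorem differentiable_rootProd : Differentiable ℂ (rootProd κ q) := by
  unfold rootProd
  fun_prop

/-- The partial fraction decomposition of `1 / Q`. -/
theorem sum_residueAt_div (hκ : 2 ≤ κ) (hq : StrictAntiOn q (Set.Icc 1 κ))
    (hx : ∀ l ∈ Finset.Icc 1 κ, x - q l ≠ 0) :
    ∑ l ∈ Finset.Icc 1 κ, (residueAt κ q l : ℂ) * (1 / (x - q l)) = 1 / rootProd κ q x := by
  have hinj : Set.InjOn (fun l => (q l : ℂ)) (Finset.Icc 1 κ : Finset ℕ) := by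
    intro i hi j hj hij
    exact hq.injOn (by simpa using hi) (by simpa using hj) (Complex.ofReal_injective hij)
  have h1 := congrArg (eval x) (Lagrange.interpolate_one hinj ⟨1, by simp; omega⟩)
  rw [Lagrange.eval_interpolate_not_at_node _ (fun l hl => sub_ne_zero.1 (hx l hl)),
    Lagrange.eval_nodal, eval_one] at h1
  have h2 : rootProd κ q x ≠ 0 := rootProd_ne_zero_iff.2 hx
  rw [eq_div_iff h2]
  refine Eq.trans ?_ h1
  rw [rootProd, mul_comm, neg_mul, ← mul_neg, ← Finset.sum_neg_distrib]
  congr 1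
  refine Finset.sum_congr rfl fun l _ => ?_
  simp only [residueAt, Lagrange.nodalWeight, Pi.one_apply]
  push_cast
  ring

theorem hasDerivAt_potential (hκ : 2 ≤ κ) (hq : StrictAntiOn q (Set.Icc 1 κ))
    (h : OffCuts κ q x) : HasDerivAt (potential κ q) (1 / rootProd κ q x) x := by
  rw [← sum_residueAt_div hκ hq fun l hl => h.sub_ne_zero hl]
  exact HasDerivAt.fun_sum fun l hl => (hasDerivAt_logSub (h l hl)).const_mul _

theorem potential_re (x : ℂ) : (potential κ q x).re
    = ∑ l ∈ Finset.Icc 1 κ, residueAt κ q l * Real.log ‖x - q l‖ := by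
  rw [potential, Complex.re_sum]
  exact Finset.sum_congr rfl fun l _ => by rw [Complex.re_ofReal_mul, logSub_re]

/-- `t` lies between the `m`-th and the `(m + 1)`-st root, counted from the right. -/
def InCell (κ : ℕ) (q : ℕ → ℝ) (m : ℕ) (t : ℝ) : Prop :=
  ∀ l ∈ Finset.Icc 1 κ, (l ≤ m → t < q l) ∧ (m < l → q l < t)

theorem inCell_of_mem_Ioo (hq : StrictAntiOn q (Set.Icc 1 κ)) {m : ℕ} {t : ℝ} (h1 : 1 ≤ m)
    (h2 : m < κ) (ht : t ∈ Set.Ioo (q (m + 1)) (q m)) : InCell κ q m t := by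
  intro l hl
  rw [Finset.mem_Icc] at hl
  refine ⟨fun h => ht.2.trans_le ?_, fun h => lt_of_le_of_lt ?_ ht.1⟩
  · exact hq.antitoneOn ⟨hl.1, hl.2⟩ ⟨h1, h2.le⟩ h
  · exact hq.antitoneOn ⟨by omega, h2⟩ ⟨hl.1, hl.2⟩ h

theorem InCell.ne {m : ℕ} {t : ℝ} (h : InCell κ q m t) {l : ℕ} (hl : l ∈ Finset.Icc 1 κ) :
    t ≠ q l := by
  rcases le_or_gt l m with h' | h'
  · exact ((h l hl).1 h').ne
  · exact ((h l hl).2 h').ne'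

theorem InCell.prod_pos {m : ℕ} {t : ℝ} (h : InCell κ q m t) (hm : m ≤ κ) :
    0 < (-1) ^ m * ∏ l ∈ Finset.Icc 1 κ, (t - q l) := by
  refine prod_sub_sign (a := 1) (by omega) hm (fun l hl => ?_) fun l hl => ?_
  · rw [Finset.mem_Icc] at hl
    exact (h l (by simp; omega)).1 hl.2
  · rw [Finset.mem_Icc] at hl
    exact (h l (by simp; omega)).2 (by omega)

theorem rootProd_ofReal (t : ℝ) :
    rootProd κ q t = ((-∏ l ∈ Finset.Icc 1 κ, (t - q l) : ℝ) : ℂ) := by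
  simp [rootProd]

/-- Exactly the `m` roots to the right contribute `π`. The weights are arbitrary because both the
residues and the constant 1 are needed, the latter to fix the branch of `logPotential`. -/
theorem sum_logSub_im_of_inCell {m : ℕ} (c : ℕ → ℝ) (h0 : x.im = 0) (h : InCell κ q m x.re)
    (hm : m ≤ κ) : ∑ l ∈ Finset.Icc 1 κ, c l * (logSub (q l) x).im
      = Real.pi * ∑ l ∈ Finset.Icc 1 m, c l := by
  have h1 : Finset.Icc 1 m ⊆ Finset.Icc 1 κ := Finset.Icc_subset_Icc_right hm
  rw [← Finset.sum_subset h1 (fun l hl hl' => ?_), Finset.mul_sum]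
  · refine Finset.sum_congr rfl fun l hl => ?_
    rw [logSub_im_of_gt h0 ((h l (h1 hl)).1 (Finset.mem_Icc.1 hl).2), mul_comm]
  · have : m < l := by
      simp only [Finset.mem_Icc] at hl hl'; omega
    rw [logSub_im_of_lt h0 ((h l hl).2 this), mul_zero]

theorem potential_im_of_inCell {m : ℕ} (h0 : x.im = 0) (h : InCell κ q m x.re) (hm : m ≤ κ) :
    (potential κ q x).im = Real.pi * residueSum κ q m := by
  rw [residueSum, ← sum_logSub_im_of_inCell _ h0 h hm, potential, Complex.im_sum]
  exact Finset.sum_congr rfl fun l _ => by rw [Complex.im_ofReal_mul]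

/-- The open upper half plane together with the bounded intervals between the roots. -/
def Regular (κ : ℕ) (q : ℕ → ℝ) (x : ℂ) : Prop :=
  0 < x.im ∨ (x.im = 0 ∧ ∃ m, 1 ≤ m ∧ m < κ ∧ InCell κ q m x.re)

theorem Regular.offCuts (h : Regular κ q x) : OffCuts κ q x := by
  intro l hl
  rcases h with h | ⟨-, m, -, -, h⟩
  · exact Or.inl h
  · exact Or.inr (h.ne hl)

/-- On a bounded interval `Q` is real of sign `-(-1)^m` and `Im F = π * S m` has sign `(-1)^m`. -/
theorem Regular.im_neg (hκ : 2 ≤ κ) (hq : StrictAntiOn q (Set.Icc 1 κ)) (h : Regular κ q x) :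
    (rootProd κ q x * potential κ q x).im < 0 := by
  rcases h with h | ⟨h0, m, h1, h2, h⟩
  · exact im_rootProd_mul_potential_neg hκ hq h
  · have e : x = (x.re : ℂ) := Complex.ext (by simp) (by simp [h0])
    have e2 : rootProd κ q x = ((-∏ l ∈ Finset.Icc 1 κ, (x.re - q l) : ℝ) : ℂ) := by
      rw [← rootProd_ofReal, ← e]
    rw [e2, Complex.im_ofReal_mul, potential_im_of_inCell h0 h h2.le]
    have h3 := mul_pos (mul_pos (h.prod_pos h2.le) (residueSum_pos hq h1 h2)) Real.pi_pos
    have e3 : (-1 : ℝ) ^ m * (-1) ^ m = 1 := by rw [← mul_pow]; simp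
    linear_combination h3 + (∏ l ∈ Finset.Icc 1 κ, (x.re - q l)) * residueSum κ q m
      * Real.pi * e3

/-- A holomorphic logarithm of the potential. -/
def logPotential (κ : ℕ) (q : ℕ → ℝ) (x : ℂ) : ℂ :=
  Complex.log (rootProd κ q x * potential κ q x) + Real.pi * Complex.I
    - ∑ l ∈ Finset.Icc 1 κ, logSub (q l) x

theorem exp_logPotential (h : rootProd κ q x * potential κ q x ≠ 0) :
    Complex.exp (logPotential κ q x) = potential κ q x := by
  have h1 := rootProd_ne_zero_iff.1 (left_ne_zero_of_mul h)
  have h2 : ∏ l ∈ Finset.Icc 1 κ, (x - q l) ≠ 0 := Finset.prod_ne_zero_iff.2 h1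
  rw [logPotential, Complex.exp_sub, Complex.exp_add, Complex.exp_log h, Complex.exp_pi_mul_I,
    Complex.exp_sum, Finset.prod_congr rfl fun l hl => exp_logSub (h1 l hl), rootProd]
  field_simp

theorem Regular.mul_ne_zero (hκ : 2 ≤ κ) (hq : StrictAntiOn q (Set.Icc 1 κ))
    (h : Regular κ q x) : rootProd κ q x * potential κ q x ≠ 0 := fun h0 => by
  have := h.im_neg hκ hq
  simp [h0] at this

theorem Regular.exp_logPotential (hκ : 2 ≤ κ) (hq : StrictAntiOn q (Set.Icc 1 κ))
    (h : Regular κ q x) : Complex.exp (logPotential κ q x) = potential κ q x :=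
  _root_.exp_logPotential (h.mul_ne_zero hκ hq)

theorem Regular.hasDerivAt_logPotential (hκ : 2 ≤ κ) (hq : StrictAntiOn q (Set.Icc 1 κ))
    (h : Regular κ q x) :
    HasDerivAt (logPotential κ q) (1 / (rootProd κ q x * potential κ q x)) x := by
  have hF := hasDerivAt_potential hκ hq h.offCuts
  have hQF : DifferentiableAt ℂ (fun x => rootProd κ q x * potential κ q x) x :=
    (differentiable_rootProd x).mul hF.differentiableAt
  have hd : DifferentiableAt ℂ (logPotential κ q) x := by
    refine ((hQF.clog (Complex.mem_slitPlane_iff.2 (Or.inr (h.im_neg hκ hq).ne))).add_const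
      _).sub ?_
    exact DifferentiableAt.fun_sum fun l hl => (hasDerivAt_logSub (h.offCuts l hl)).differentiableAt
  -- The identity needs only `QF ≠ 0`, hence holds in a full neighbourhood even at real points,
  -- where the regular set is not open.
  have hev : ∀ᶠ y in 𝓝 x, Complex.exp (logPotential κ q y) = potential κ q y :=
    (hQF.continuousAt.eventually_ne (h.mul_ne_zero hκ hq)).mono fun y hy =>
      _root_.exp_logPotential hy
  have h1 := hd.hasDerivAt.cexp.unique (hF.congr_of_eventuallyEq hev)
  have h2 := hd.hasDerivAt
  rw [h.exp_logPotential hκ hq] at h1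
  have hne := h.mul_ne_zero hκ hq
  refine h2.congr_deriv ?_
  have := left_ne_zero_of_mul hne
  have := right_ne_zero_of_mul hne
  field_simp
  field_simp at h1
  linear_combination h1

theorem Regular.im_deriv_pos (hκ : 2 ≤ κ) (hq : StrictAntiOn q (Set.Icc 1 κ))
    (h : Regular κ q x) : 0 < (1 / (rootProd κ q x * potential κ q x)).im := by
  rw [one_div, Complex.inv_im]
  exact div_pos (neg_pos.2 (h.im_neg hκ hq)) (Complex.normSq_pos.2 (h.mul_ne_zero hκ hq))

theorem logPotential_im (x : ℂ) : (logPotential κ q x).im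
    = Complex.arg (rootProd κ q x * potential κ q x) + Real.pi
      - ∑ l ∈ Finset.Icc 1 κ, (logSub (q l) x).im := by
  rw [logPotential, Complex.sub_im, Complex.add_im, Complex.log_im, Complex.im_sum,
    Complex.im_ofReal_mul, Complex.I_im, mul_one]

/-- The Noshiro–Warschawski inequality. -/
theorem im_div_pos_of_segment (hκ : 2 ≤ κ) (hq : StrictAntiOn q (Set.Icc 1 κ)) {y : ℂ}
    (hxy : x ≠ y) (h : ∀ z ∈ segment ℝ x y, Regular κ q z) :
    0 < ((logPotential κ q y - logPotential κ q x) / (y - x)).im := by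
  have hne : y - x ≠ 0 := sub_ne_zero.2 hxy.symm
  -- Dividing by `y - x` cancels the chain-rule factor, leaving the imaginary part of the derivative
  -- of `logPotential`.
  set φ : ℝ → ℝ := fun t => (logPotential κ q (x + t * (y - x)) / (y - x)).im with hφ
  have hseg : ∀ t ∈ Set.Icc (0 : ℝ) 1, Regular κ q (x + t * (y - x)) := fun t ht => by
    refine h _ ?_
    rw [segment_eq_image']
    exact ⟨t, ht, by simp⟩
  have hd : ∀ t ∈ Set.Icc (0 : ℝ) 1, HasDerivAt φ (1 / (rootProd κ q (x + t * (y - x)) *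
      potential κ q (x + t * (y - x)))).im t := by
    intro t ht
    have h1 : HasDerivAt (fun t : ℂ => x + t * (y - x)) (y - x) (t : ℂ) := by
      simpa using ((hasDerivAt_id (t : ℂ)).mul_const (y - x)).const_add x
    have h2 := ((((hseg t ht).hasDerivAt_logPotential hκ hq).comp (t : ℂ) h1).div_const
      (y - x)).comp_ofReal
    have h3 := Complex.imCLM.hasFDerivAt.comp_hasDerivAt t h2
    refine HasDerivAt.congr_deriv (f := φ) h3 ?_
    rw [Complex.imCLM_apply, mul_div_cancel_right₀ _ hne]
  have hmono : StrictMonoOn φ (Set.Icc 0 1) := by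
    refine strictMonoOn_of_deriv_pos (convex_Icc _ _)
      (fun t ht => (hd t ht).continuousAt.continuousWithinAt) fun t ht => ?_
    have ht' := interior_subset ht
    rw [(hd t ht').deriv]
    exact (hseg t ht').im_deriv_pos hκ hq
  have := hmono (Set.left_mem_Icc.2 zero_le_one) (Set.right_mem_Icc.2 zero_le_one) zero_lt_one
  rw [sub_div, Complex.sub_im, sub_pos]
  simpa [hφ] using this

end Potential

/-! ### Level curves -/

/-- The argument of the potential along the `j`-th separatrix. -/
def levelArg (j : ℕ) : ℝ := -((j : ℝ) - 1 / 2) * Real.pi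

section LevelCurve

variable {κ : ℕ} {q : ℕ → ℝ}

/-- A residue is the difference of consecutive partial sums, whose signs alternate; at either end
one of them is zero, but never both. -/
theorem residueAt_pos (hκ : 2 ≤ κ) (hq : StrictAntiOn q (Set.Icc 1 κ)) {l : ℕ} (h1 : 1 ≤ l)
    (h2 : l ≤ κ) : 0 < (-1) ^ l * residueAt κ q l := by
  obtain ⟨m, rfl⟩ : ∃ m, l = m + 1 := ⟨l - 1, by omega⟩
  have e : residueSum κ q (m + 1) = residueSum κ q m + residueAt κ q (m + 1) :=
    Finset.sum_Icc_succ_top (by omega) _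
  have e' : residueAt κ q (m + 1) = residueSum κ q (m + 1) - residueSum κ q m := by linarith
  have ha : 0 ≤ (-1) ^ (m + 1) * residueSum κ q (m + 1) := by
    rcases h2.eq_or_lt with h | h
    · rw [h, residueSum_self hκ hq, mul_zero]
    · exact (residueSum_pos hq h1 h).le
  have hb : 0 ≤ (-1) ^ m * residueSum κ q m := by
    rcases Nat.eq_zero_or_pos m with rfl | h
    · simp [residueSum]
    · exact (residueSum_pos hq h h2).le
  have hne : 0 < (-1) ^ (m + 1) * residueSum κ q (m + 1) ∨ 0 < (-1) ^ m * residueSum κ q m := by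
    rcases h2.eq_or_lt with h | h
    · exact Or.inr (residueSum_pos hq (by omega) h2)
    · exact Or.inl (residueSum_pos hq h1 h)
  rw [e', mul_sub, pow_succ]
  rw [pow_succ] at ha hne
  rcases hne with h | h <;> linarith

theorem tendsto_log_norm_sub (q0 : ℝ) :
    Tendsto (fun t : ℝ => Real.log ‖(t : ℂ) - q0‖) (𝓝[≠] q0) atBot := by
  have h1 : Tendsto (fun t : ℝ => t - q0) (𝓝[≠] q0) (𝓝[≠] 0) := by
    refine tendsto_nhdsWithin_iff.2 ⟨?_, ?_⟩
    · have : Tendsto (fun t : ℝ => t - q0) (𝓝 q0) (𝓝 (q0 - q0)) := by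
        exact (continuous_id.sub continuous_const).tendsto q0
      rw [sub_self] at this
      exact this.mono_left nhdsWithin_le_nhds
    · filter_upwards [self_mem_nhdsWithin] with t ht
      exact sub_ne_zero.2 ht
  refine (Real.tendsto_log_nhdsNE_zero.comp h1).congr fun t => ?_
  rw [Function.comp, ← Complex.ofReal_sub, Complex.norm_real, Real.norm_eq_abs, Real.log_abs]

/-- Near a root the logarithmic singularity dominates the real part of the potential. -/
theorem tendsto_potential_re_root (hκ : 2 ≤ κ) (hq : StrictAntiOn q (Set.Icc 1 κ)) {m : ℕ}
    (h1 : 1 ≤ m) (h2 : m ≤ κ) :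
    Tendsto (fun t : ℝ => (-1) ^ m * (potential κ q t).re) (𝓝[≠] q m) atBot := by
  have hm : m ∈ Finset.Icc 1 κ := by simp; omega
  have h3 := (tendsto_log_norm_sub (q m)).const_mul_atBot (residueAt_pos hκ hq h1 h2)
  have h4 : ContinuousAt (fun t : ℝ => ∑ l ∈ (Finset.Icc 1 κ).erase m,
      (-1) ^ m * (residueAt κ q l * Real.log ‖(t : ℂ) - q l‖)) (q m) := by
    refine tendsto_finsetSum _ fun l hl => ?_
    rw [Finset.mem_erase, Finset.mem_Icc] at hl
    have hne : (q m : ℂ) - q l ≠ 0 := by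
      rw [← Complex.ofReal_sub, Complex.ofReal_ne_zero, sub_ne_zero]
      exact fun h => hl.1 (hq.injOn ⟨hl.2.1, hl.2.2⟩ ⟨h1, h2⟩ h.symm)
    have : ContinuousAt (fun t : ℝ => ‖(t : ℂ) - q l‖) (q m) := by fun_prop
    exact ((this.log (norm_ne_zero_iff.2 hne)).const_mul _).const_mul _
  have h5 := h3.atBot_add (h4.tendsto.mono_left nhdsWithin_le_nhds)
  refine h5.congr fun t => ?_
  rw [potential_re, ← Finset.add_sum_erase _ _ hm, mul_add, Finset.mul_sum, mul_assoc]

/-- Residues at neighbouring roots have opposite signs, so `Re F` tends to opposite infinities at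
the two ends of the interval. -/
theorem exists_potential_re_eq_zero (hκ : 2 ≤ κ) (hq : StrictAntiOn q (Set.Icc 1 κ)) {j : ℕ}
    (h1 : 1 ≤ j) (h2 : j < κ) :
    ∃ p ∈ Set.Ioo (q (j + 1)) (q j), (potential κ q p).re = 0 := by
  have hlt : q (j + 1) < q j := hq ⟨h1, h2.le⟩ ⟨by omega, h2⟩ (by omega)
  have hcont : ContinuousOn (fun t : ℝ => (-1) ^ j * (potential κ q t).re)
      (Set.Ioo (q (j + 1)) (q j)) := by
    intro t ht
    have hoff : OffCuts κ q t := fun l hl => Or.inr ((inCell_of_mem_Ioo hq h1 h2 ht).ne hl)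
    have h3 : ContinuousAt (fun t : ℝ => (potential κ q t)) t :=
      (hasDerivAt_potential hκ hq hoff).continuousAt.comp Complex.continuous_ofReal.continuousAt
    exact ((Complex.continuous_re.continuousAt.comp h3).const_mul _).continuousWithinAt
  obtain ⟨t₁, ha, ha'⟩ : ∃ t ∈ Set.Ioo (q (j + 1)) (q j), (-1) ^ j * (potential κ q t).re < 0 := by
    have := (tendsto_potential_re_root hκ hq h1 h2.le).mono_left
      (nhdsWithin_mono (q j) (s := Set.Iio (q j)) fun t ht => (Set.mem_Iio.1 ht).ne)
    obtain ⟨t, ht⟩ := ((this.eventually_lt_atBot 0).and (Ioo_mem_nhdsLT hlt)).exists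
    exact ⟨t, ht.2, ht.1⟩
  obtain ⟨t₂, hb, hb'⟩ : ∃ t ∈ Set.Ioo (q (j + 1)) (q j), 0 < (-1) ^ j * (potential κ q t).re := by
    have := (tendsto_potential_re_root hκ hq (m := j + 1) (by omega) h2).mono_left
      (nhdsWithin_mono (q (j + 1)) (s := Set.Ioi (q (j + 1))) fun t ht => (Set.mem_Ioi.1 ht).ne')
    obtain ⟨t, ht⟩ := ((this.eventually_lt_atBot 0).and (Ioo_mem_nhdsGT hlt)).exists
    refine ⟨t, ht.2, ?_⟩
    have := ht.1
    rw [pow_succ] at this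
    linarith
  obtain ⟨p, hp, hp'⟩ := isPreconnected_Ioo.intermediate_value ha hb hcont ⟨ha'.le, hb'.le⟩
  exact ⟨p, hp, by simpa using hp'⟩

theorem segment_mk_mem {u v u' v' : ℝ} {z : ℂ}
    (hz : z ∈ segment ℝ (⟨u, v⟩ : ℂ) ⟨u', v'⟩) :
    ∃ a b : ℝ, 0 ≤ a ∧ 0 ≤ b ∧ a + b = 1 ∧ z = ⟨a * u + b * u', a * v + b * v'⟩ := by
  obtain ⟨a, b, ha, hb, hab, rfl⟩ := hz
  exact ⟨a, b, ha, hb, hab, by apply Complex.ext <;> simp⟩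

theorem logPotential_im_lt (hκ : 2 ≤ κ) (hq : StrictAntiOn q (Set.Icc 1 κ)) {u v y : ℝ}
    (huv : u < v) (h : ∀ t ∈ Set.Icc u v, Regular κ q ⟨t, y⟩) :
    (logPotential κ q ⟨u, y⟩).im < (logPotential κ q ⟨v, y⟩).im := by
  have h1 := im_div_pos_of_segment hκ hq (x := ⟨u, y⟩) (y := ⟨v, y⟩)
    (fun e => huv.ne (congrArg Complex.re e)) fun z hz => by
      obtain ⟨a, b, ha, hb, hab, rfl⟩ := segment_mk_mem hz
      have e : a * y + b * y = y := by rw [← add_mul, hab, one_mul]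
      rw [e]
      obtain rfl : a = 1 - b := by linarith
      have hvu := sub_nonneg.2 huv.le
      exact h _ ⟨by linarith [mul_nonneg hb hvu], by linarith [mul_nonneg ha hvu]⟩
  have e : (⟨v, y⟩ : ℂ) - ⟨u, y⟩ = ((v - u : ℝ) : ℂ) := by apply Complex.ext <;> simp
  rw [e, Complex.div_ofReal_im] at h1
  have := (div_pos_iff_of_pos_right (sub_pos.2 huv)).1 h1
  simpa using this

theorem logPotential_im_lt_of_pos (hκ : 2 ≤ κ) (hq : StrictAntiOn q (Set.Icc 1 κ)) {u v y : ℝ}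
    (huv : u < v) (hy : 0 < y) :
    (logPotential κ q ⟨u, y⟩).im < (logPotential κ q ⟨v, y⟩).im :=
  logPotential_im_lt hκ hq huv fun _ _ => Or.inl hy

theorem continuous_mk (y : ℝ) : Continuous fun u : ℝ => (⟨u, y⟩ : ℂ) := by
  simp_rw [Complex.mk_eq_add_mul_I]; fun_prop

theorem tendsto_logSub_im_atTop {t y : ℝ} (hy : 0 < y) :
    Tendsto (fun u : ℝ => (logSub t ⟨u, y⟩).im) atTop (𝓝 0) := by
  have h1 : Tendsto (fun u : ℝ => (u - t) / y) atTop atTop :=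
    (tendsto_atTop_add_const_right _ (-t) tendsto_id).atTop_div_const hy
  have h2 := ((Real.tendsto_arctan_atTop.mono_right nhdsWithin_le_nhds).comp h1).const_sub
    (Real.pi / 2)
  rw [sub_self] at h2
  exact h2.congr fun u => (logSub_im_eq_arctan (x := ⟨u, y⟩) hy).symm

theorem tendsto_logSub_im_atBot {t y : ℝ} (hy : 0 < y) :
    Tendsto (fun u : ℝ => (logSub t ⟨u, y⟩).im) atBot (𝓝 Real.pi) := by
  have h1 : Tendsto (fun u : ℝ => (u - t) / y) atBot atBot :=
    (tendsto_atBot_add_const_right _ (-t) tendsto_id).atBot_div_const hy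
  have h2 := ((Real.tendsto_arctan_atBot.mono_right nhdsWithin_le_nhds).comp h1).const_sub
    (Real.pi / 2)
  rw [sub_neg_eq_add, add_halves] at h2
  exact h2.congr fun u => (logSub_im_eq_arctan (x := ⟨u, y⟩) hy).symm

/-- Intermediate values. As `arg (QF)` lies in `(-π, 0)`, far to the right the argument exceeds
`-π/2 = levelArg 1`, and far to the left it is below `-(κ - 3/2)π = levelArg (κ - 1)`. All levels
with `1 ≤ j < κ` lie in between. -/
theorem exists_logPotential_im_eq (hκ : 2 ≤ κ) (hq : StrictAntiOn q (Set.Icc 1 κ)) {j : ℕ}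
    (h1 : 1 ≤ j) (h2 : j < κ) {y : ℝ} (hy : 0 < y) :
    ∃ u : ℝ, (logPotential κ q ⟨u, y⟩).im = levelArg j := by
  have hcont : Continuous fun u : ℝ => (logPotential κ q ⟨u, y⟩).im := by
    refine continuous_iff_continuousAt.2 fun u => ?_
    have h : Regular κ q ⟨u, y⟩ := Or.inl hy
    exact Complex.continuous_im.continuousAt.comp
      (ContinuousAt.comp (f := fun u : ℝ => (⟨u, y⟩ : ℂ))
        (h.hasDerivAt_logPotential hκ hq).continuousAt (continuous_mk y).continuousAt)
  have harg : ∀ u : ℝ, Complex.arg (rootProd κ q ⟨u, y⟩ * potential κ q ⟨u, y⟩) < 0 := fun u =>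
    Complex.arg_neg_iff.2 (Regular.im_neg hκ hq (Or.inl hy))
  have hj1 : (1 : ℝ) ≤ j := by exact_mod_cast h1
  have hj2 : (j : ℝ) + 1 ≤ κ := by exact_mod_cast h2
  have hpi := Real.pi_pos
  have htop : ∃ u : ℝ, levelArg j ≤ (logPotential κ q ⟨u, y⟩).im := by
    have ht : Tendsto (fun u : ℝ => ∑ l ∈ Finset.Icc 1 κ, (logSub (q l) ⟨u, y⟩).im) atTop
        (𝓝 (∑ l ∈ Finset.Icc 1 κ, 0)) :=
      tendsto_finsetSum _ fun l _ => tendsto_logSub_im_atTop hy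
    rw [Finset.sum_const_zero] at ht
    obtain ⟨u, hu⟩ := (ht.eventually_lt_const (half_pos hpi)).exists
    refine ⟨u, ?_⟩
    rw [logPotential_im, levelArg]
    have := Complex.neg_pi_lt_arg (rootProd κ q ⟨u, y⟩ * potential κ q ⟨u, y⟩)
    nlinarith
  have hbot : ∃ u : ℝ, (logPotential κ q ⟨u, y⟩).im ≤ levelArg j := by
    have ht : Tendsto (fun u : ℝ => ∑ l ∈ Finset.Icc 1 κ, (logSub (q l) ⟨u, y⟩).im) atBot
        (𝓝 (∑ l ∈ Finset.Icc 1 κ, Real.pi)) :=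
      tendsto_finsetSum _ fun l _ => tendsto_logSub_im_atBot hy
    rw [Finset.sum_const, Nat.card_Icc, Nat.add_sub_cancel, nsmul_eq_mul] at ht
    obtain ⟨u, hu⟩ := (ht.eventually_const_lt (u := κ * Real.pi - Real.pi / 2)
      (by linarith)).exists
    refine ⟨u, ?_⟩
    rw [logPotential_im, levelArg]
    have := harg u
    nlinarith
  obtain ⟨u, hu⟩ := htop
  obtain ⟨v, hv⟩ := hbot
  exact mem_range_of_exists_le_of_exists_ge hcont ⟨v, hv⟩ ⟨u, hu⟩

/-- At such a point `QF` is negative imaginary and the `j` roots to the right contribute `jπ`, so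
the argument is `-π/2 + π - jπ`. -/
theorem logPotential_im_of_re_eq_zero (hκ : 2 ≤ κ) (hq : StrictAntiOn q (Set.Icc 1 κ)) {j : ℕ}
    (h1 : 1 ≤ j) (h2 : j < κ) {p : ℝ} (hp : InCell κ q j p) (h0 : (potential κ q p).re = 0) :
    (logPotential κ q p).im = levelArg j := by
  have hreg : Regular κ q p := Or.inr ⟨Complex.ofReal_im p, j, h1, h2, by simpa using hp⟩
  have h3 := sum_logSub_im_of_inCell (κ := κ) (q := q) (x := p) (fun _ => 1)
    (Complex.ofReal_im p) (by simpa using hp) h2.le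
  have h4 := hreg.im_neg hκ hq
  have h5 : Complex.arg (rootProd κ q p * potential κ q p) = -(Real.pi / 2) := by
    refine Complex.arg_eq_neg_pi_div_two_iff.2 ⟨?_, h4⟩
    rw [rootProd_ofReal, Complex.re_ofReal_mul, h0, mul_zero]
  simp only [one_mul, Finset.sum_const, Nat.card_Icc, Nat.add_sub_cancel, nsmul_eq_mul,
    mul_one] at h3
  rw [logPotential_im, h3, h5, levelArg]
  ring

theorem Regular.potential_eq_of_level (hκ : 2 ≤ κ) (hq : StrictAntiOn q (Set.Icc 1 κ)) {j : ℕ}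
    {x : ℂ} (hx : Regular κ q x) (h : (logPotential κ q x).im = levelArg j) :
    potential κ q x = ‖potential κ q x‖ * (Complex.I * (-1) ^ j) := by
  have h1 := hx.exp_logPotential hκ hq
  have h2 : Complex.exp (levelArg j * Complex.I) = Complex.I * (-1) ^ j := by
    have e : (levelArg j * Complex.I : ℂ)
        = Real.pi / 2 * Complex.I - j * (Real.pi * Complex.I) := by
      rw [levelArg]; push_cast; ring
    rw [e, Complex.exp_sub, Complex.exp_pi_div_two_mul_I, Complex.exp_nat_mul,
      Complex.exp_pi_mul_I, div_eq_mul_inv, ← inv_pow]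
    norm_num
  rw [← h1, Complex.norm_exp, ← h2, ← h, Complex.ofReal_exp, ← Complex.exp_add,
    Complex.re_add_im]

/-- The modulus of the potential decreases upwards along a level curve of its argument. -/
theorem norm_potential_lt (hκ : 2 ≤ κ) (hq : StrictAntiOn q (Set.Icc 1 κ)) {x y : ℂ}
    (hx : Regular κ q x) (hxy : x.im < y.im) (hx0 : 0 ≤ x.im)
    (h : (logPotential κ q x).im = (logPotential κ q y).im) :
    ‖potential κ q y‖ < ‖potential κ q x‖ := by
  have hy : Regular κ q y := Or.inl (hx0.trans_lt hxy)
  have h1 := im_div_pos_of_segment hκ hq (x := x) (y := y)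
    (fun e => hxy.ne (congrArg Complex.im e)) fun z hz => by
      obtain ⟨a, b, ha, hb, hab, rfl⟩ := hz
      rcases hb.eq_or_lt with rfl | hb
      · have : a = 1 := by linarith
        simpa [this] using hx
      · refine Or.inl ?_
        simp only [Complex.add_im, Complex.real_smul, Complex.im_ofReal_mul]
        have := mul_pos hb (hx0.trans_lt hxy)
        have := mul_nonneg ha hx0
        linarith
  have e : logPotential κ q y - logPotential κ q x
      = (((logPotential κ q y).re - (logPotential κ q x).re : ℝ) : ℂ) := by
    apply Complex.ext <;> simp [h]
  rw [e, div_eq_mul_inv, Complex.im_ofReal_mul, Complex.inv_im, Complex.sub_im] at h1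
  rw [← hx.exp_logPotential hκ hq, ← hy.exp_logPotential hκ hq, Complex.norm_exp,
    Complex.norm_exp, Real.exp_lt_exp]
  have h2 : -(y.im - x.im) / Complex.normSq (y - x) ≤ 0 :=
    div_nonpos_of_nonpos_of_nonneg (by linarith) (Complex.normSq_nonneg _)
  by_contra h3
  have := mul_nonpos_of_nonneg_of_nonpos (sub_nonneg.2 (not_lt.1 h3)) h2
  linarith

/-- The strict inequalities on either side of the level at `w y₀ ± η` persist at nearby heights, and
monotonicity along horizontal lines then traps `w y`. -/
theorem continuousWithinAt_level {j : ℕ} {w : ℝ → ℝ} {y₀ : ℝ} (hκ : 2 ≤ κ)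
    (hq : StrictAntiOn q (Set.Icc 1 κ)) (hy₀ : 0 ≤ y₀)
    (hreg : Regular κ q ⟨w y₀, y₀⟩)
    (hw : ∀ y, 0 ≤ y → (logPotential κ q ⟨w y, y⟩).im = levelArg j) :
    ContinuousWithinAt w (Set.Ici 0) y₀ := by
  have hreg' : ∃ δ > 0, ∀ t ∈ Set.Icc (w y₀ - δ) (w y₀ + δ), Regular κ q ⟨t, y₀⟩ := by
    rcases hreg with h | ⟨h0, m, h1, h2, h⟩
    · exact ⟨1, one_pos, fun t _ => Or.inl h⟩
    · have hev : ∀ᶠ t in 𝓝 (w y₀), InCell κ q m t := by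
        have : ∀ l ∈ Finset.Icc 1 κ, ∀ᶠ t in 𝓝 (w y₀), (l ≤ m → t < q l) ∧ (m < l → q l < t) := by
          intro l hl
          refine Filter.Eventually.and ?_ ?_
          · by_cases hlm : l ≤ m
            · exact (eventually_lt_nhds ((h l hl).1 hlm)).mono fun _ h _ => h
            · exact Eventually.of_forall fun _ h => absurd h hlm
          · by_cases hlm : m < l
            · exact (eventually_gt_nhds ((h l hl).2 hlm)).mono fun _ h _ => h
            · exact Eventually.of_forall fun _ h => absurd h hlm
        exact (Filter.eventually_all_finset _).2 this
      obtain ⟨δ, hδ, hb⟩ := Metric.nhds_basis_closedBall.eventually_iff.1 hev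
      refine ⟨δ, hδ, fun t ht => Or.inr ⟨h0, m, h1, h2, hb ?_⟩⟩
      rwa [Real.closedBall_eq_Icc]
  obtain ⟨δ, hδ, hδr⟩ := hreg'
  rw [Metric.continuousWithinAt_iff']
  intro ε hε
  set η := min δ (ε / 2) with hη
  have hη0 : 0 < η := lt_min hδ (half_pos hε)
  have hηδ : η ≤ δ := min_le_left _ _
  have hηε : η < ε := (min_le_right _ _).trans_lt (half_lt_self hε)
  have hc : ∀ u : ℝ, u ∈ Set.Icc (w y₀ - δ) (w y₀ + δ) →
      ContinuousAt (fun y : ℝ => (logPotential κ q ⟨u, y⟩).im) y₀ := fun u hu => by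
    have hcm : Continuous fun y : ℝ => (⟨u, y⟩ : ℂ) := by
      simp_rw [Complex.mk_eq_add_mul_I]; fun_prop
    exact Complex.continuous_im.continuousAt.comp
      (ContinuousAt.comp (f := fun y : ℝ => (⟨u, y⟩ : ℂ))
        ((hδr u hu).hasDerivAt_logPotential hκ hq).continuousAt hcm.continuousAt)
  have hlo : (logPotential κ q ⟨w y₀ - η, y₀⟩).im < levelArg j := by
    rw [← hw y₀ hy₀]
    exact logPotential_im_lt hκ hq (by linarith) fun t ht =>
      hδr t ⟨by linarith [ht.1], by linarith [ht.2]⟩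
  have hhi : levelArg j < (logPotential κ q ⟨w y₀ + η, y₀⟩).im := by
    rw [← hw y₀ hy₀]
    exact logPotential_im_lt hκ hq (by linarith) fun t ht =>
      hδr t ⟨by linarith [ht.1], by linarith [ht.2]⟩
  have e1 := (hc (w y₀ - η) ⟨by linarith, by linarith⟩).eventually_lt continuousAt_const hlo
  have e2 := continuousAt_const.eventually_lt (hc (w y₀ + η) ⟨by linarith, by linarith⟩) hhi
  -- Global horizontal monotonicity is available only at positive height, so the base point is
  -- treated separately when `y₀ = 0`.
  have e3 : ∀ᶠ y in 𝓝[Set.Ici 0] y₀, y = y₀ ∨ 0 < y := by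
    rcases hy₀.eq_or_lt with rfl | h0
    · filter_upwards [self_mem_nhdsWithin] with y hy
      exact (Set.mem_Ici.1 hy).eq_or_lt.imp_left Eq.symm
    · exact nhdsWithin_le_nhds ((eventually_gt_nhds h0).mono fun _ h => Or.inr h)
  filter_upwards [nhdsWithin_le_nhds e1, nhdsWithin_le_nhds e2, e3] with y hy1 hy2 hy
  rcases hy with rfl | hpos
  · rw [dist_self]; exact hε
  · rw [Real.dist_eq, abs_lt]
    rw [← hw y hpos.le] at hy1 hy2
    constructor
    · by_contra hcon
      have : w y < w y₀ - η := by linarith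
      linarith [logPotential_im_lt_of_pos hκ hq this hpos]
    · by_contra hcon
      have : w y₀ + η < w y := by linarith
      linarith [logPotential_im_lt_of_pos hκ hq this hpos]

end LevelCurve

/-! ### Behaviour at infinity -/

/-- The neighbourhoods of infinity in the open upper half plane. -/
def upperInfinity : Filter ℂ := Bornology.cobounded ℂ ⊓ 𝓟 {x | 0 < x.im}

theorem eventually_upperInfinity_im_pos : ∀ᶠ x in upperInfinity, 0 < x.im :=
  mem_inf_of_right (mem_principal_self _)

theorem tendsto_div_cobounded (t : ℂ) :
    Tendsto (fun x : ℂ => t / x) (Bornology.cobounded ℂ) (𝓝 0) := by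
  simpa [div_eq_mul_inv] using (tendsto_inv₀_cobounded (α := ℂ)).const_mul t

theorem logSub_zero_eq_log {x : ℂ} (h : 0 < x.im) : logSub 0 x = Complex.log x := by
  have h1 : x - (0 : ℝ) ≠ 0 := sub_ofReal_ne_zero (Or.inl h)
  conv_rhs => rw [← sub_zero x, ← Complex.ofReal_zero, ← exp_logSub h1]
  rw [Complex.log_exp]
  · linarith [logSub_im_pos (t := 0) h, Real.pi_pos]
  · exact (logSub_im_lt_pi h).le

/-- Both logarithms have imaginary part in `(0, π)`, so no multiple of `2πi` can appear. -/
theorem logSub_eq_add {t : ℝ} {x : ℂ} (h : 0 < x.im) :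
    logSub t x = Complex.log x + Complex.log (1 + -t / x) := by
  have h0 : x - (0 : ℝ) ≠ 0 := sub_ofReal_ne_zero (Or.inl h)
  have h1 : x - t ≠ 0 := sub_ofReal_ne_zero (Or.inl h)
  have hx : x ≠ 0 := by simpa using h0
  have e : 1 + -t / x = Complex.exp (logSub t x - logSub 0 x) := by
    rw [Complex.exp_sub, exp_logSub h0, exp_logSub h1]
    field_simp
    push_cast
    ring
  have hp := logSub_im_pos (t := t) h
  have hp0 := logSub_im_pos (t := 0) h
  have hl := logSub_im_lt_pi (t := t) h
  have hl0 := logSub_im_lt_pi (t := 0) h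
  rw [e, Complex.log_exp, ← logSub_zero_eq_log h]
  · ring
  · rw [Complex.sub_im]; linarith
  · rw [Complex.sub_im]; linarith

theorem tendsto_log_one_add_div (t : ℂ) :
    Tendsto (fun x : ℂ => Complex.log (1 + t / x)) (Bornology.cobounded ℂ) (𝓝 0) := by
  have h1 : Tendsto (fun x : ℂ => 1 + t / x) (Bornology.cobounded ℂ) (𝓝 1) := by
    simpa using (tendsto_div_cobounded t).const_add 1
  have h2 : ContinuousAt Complex.log 1 := continuousAt_clog Complex.one_mem_slitPlane
  have := h2.tendsto.comp h1
  rwa [Complex.log_one] at this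

theorem tendsto_pow_mul_log_sub_logTaylor (n : ℕ) (t : ℂ) :
    Tendsto (fun x : ℂ => x ^ n * (Complex.log (1 + t / x) - Complex.logTaylor (n + 1) (t / x)))
      (Bornology.cobounded ℂ) (𝓝 0) := by
  have h1 := (Complex.log_sub_logTaylor_isBigO n).comp_tendsto (tendsto_div_cobounded t)
  have h2 := (Asymptotics.isBigO_refl (fun x : ℂ => x ^ n) (Bornology.cobounded ℂ)).mul h1
  refine h2.trans_tendsto ?_
  have h3 := (tendsto_div_cobounded (t ^ (n + 1)))
  refine h3.congr' ?_
  filter_upwards [Bornology.eventually_ne_cobounded (0 : ℂ)] with x hx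
  simp only [Function.comp, div_pow]
  field_simp
  ring

section Infinity

variable {κ : ℕ} {q : ℕ → ℝ}

theorem sum_residueAt (hκ : 2 ≤ κ) (hq : StrictAntiOn q (Set.Icc 1 κ)) :
    ∑ l ∈ Finset.Icc 1 κ, residueAt κ q l = 0 := residueSum_self hκ hq

theorem potential_eq_sum_log (hκ : 2 ≤ κ) (hq : StrictAntiOn q (Set.Icc 1 κ)) {x : ℂ}
    (h : 0 < x.im) : potential κ q x
      = ∑ l ∈ Finset.Icc 1 κ, (residueAt κ q l : ℂ) * Complex.log (1 + -q l / x) := by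
  have h1 : ∑ l ∈ Finset.Icc 1 κ, (residueAt κ q l : ℂ) = 0 := by
    exact_mod_cast sum_residueAt hκ hq
  simp_rw [potential, logSub_eq_add h, mul_add]
  rw [Finset.sum_add_distrib, ← Finset.sum_mul, h1, zero_mul, zero_add]

theorem sum_residueAt_mul_logTaylor (hκ : 2 ≤ κ) (hq : StrictAntiOn q (Set.Icc 1 κ)) (x : ℂ) :
    ∑ l ∈ Finset.Icc 1 κ, (residueAt κ q l : ℂ) * Complex.logTaylor κ (-q l / x)
      = 1 / ((κ - 1 : ℕ) * x ^ (κ - 1)) := by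
  simp_rw [Complex.logTaylor, Finset.mul_sum]
  rw [Finset.sum_comm]
  have h1 : ∀ n ∈ Finset.range κ, ∑ l ∈ Finset.Icc 1 κ,
      (residueAt κ q l : ℂ) * ((-1) ^ (n + 1) * (-q l / x) ^ n / n)
      = if n = κ - 1 then 1 / ((κ - 1 : ℕ) * x ^ (κ - 1)) else 0 := by
    intro n hn
    have h2 : ∑ l ∈ Finset.Icc 1 κ, (residueAt κ q l : ℂ) * (q l : ℂ) ^ n
        = if n = κ - 1 then -1 else 0 := by
      have := sum_residueAt_mul_pow hq (Finset.mem_range.1 hn)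
      split_ifs at this ⊢ <;> exact_mod_cast this
    have e : (-1 : ℂ) ^ n * (-1) ^ n = 1 := by rw [← mul_pow]; simp
    calc _ = -(1 / (n * x ^ n)) * ∑ l ∈ Finset.Icc 1 κ, (residueAt κ q l : ℂ) * (q l : ℂ) ^ n := by
          rw [Finset.mul_sum]
          refine Finset.sum_congr rfl fun l _ => ?_
          rw [div_pow, neg_pow (q l : ℂ), pow_succ]
          linear_combination (-(residueAt κ q l : ℂ) * (q l : ℂ) ^ n / (x ^ n * n)) * e
      _ = _ := by
          rw [h2]
          split_ifs with h
          · rw [h]; ring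
          · simp
  rw [Finset.sum_congr rfl h1, Finset.sum_ite_eq' , if_pos (by simp; omega)]

/-- Expand each `log (1 - q l / x)` to order `κ - 1`: by the moment identities only the last power
survives. -/
theorem tendsto_pow_mul_potential (hκ : 2 ≤ κ) (hq : StrictAntiOn q (Set.Icc 1 κ)) :
    Tendsto (fun x => x ^ (κ - 1) * potential κ q x) upperInfinity
      (𝓝 (1 / (κ - 1 : ℕ))) := by
  obtain ⟨n, rfl⟩ : ∃ n, κ = n + 1 := ⟨κ - 1, by omega⟩
  have h1 : Tendsto (fun x : ℂ => ∑ l ∈ Finset.Icc 1 (n + 1), (residueAt (n + 1) q l : ℂ) *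
      (x ^ n * (Complex.log (1 + -q l / x) - Complex.logTaylor (n + 1) (-q l / x))))
      upperInfinity (𝓝 (∑ l ∈ Finset.Icc 1 (n + 1), (residueAt (n + 1) q l : ℂ) * 0)) :=
    tendsto_finsetSum _ fun l _ =>
      ((tendsto_pow_mul_log_sub_logTaylor n (-q l)).mono_left inf_le_left).const_mul _
  simp only [mul_zero, Finset.sum_const_zero] at h1
  have h2 := h1.add_const (1 / (n : ℂ))
  rw [zero_add] at h2
  rw [Nat.add_sub_cancel]
  refine h2.congr' ?_
  filter_upwards [eventually_upperInfinity_im_pos] with x hx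
  have hx0 : x ≠ 0 := fun h => by simp [h] at hx
  rw [potential_eq_sum_log hκ hq hx]
  have h3 := sum_residueAt_mul_logTaylor hκ hq x
  rw [Nat.add_sub_cancel] at h3
  have e : (1 / (n : ℂ)) = x ^ n * (1 / (n * x ^ n)) := by
    have := pow_ne_zero n hx0
    field_simp
  rw [e, ← h3, Finset.mul_sum, Finset.mul_sum, ← Finset.sum_add_distrib]
  exact Finset.sum_congr rfl fun l _ => by ring

theorem tendsto_potential_zero (hκ : 2 ≤ κ) (hq : StrictAntiOn q (Set.Icc 1 κ)) :
    Tendsto (potential κ q) upperInfinity (𝓝 0) := by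
  have h1 : Tendsto (fun x : ℂ => ∑ l ∈ Finset.Icc 1 κ, (residueAt κ q l : ℂ) *
      Complex.log (1 + -q l / x)) upperInfinity
      (𝓝 (∑ l ∈ Finset.Icc 1 κ, (residueAt κ q l : ℂ) * 0)) :=
    tendsto_finsetSum _ fun l _ =>
      ((tendsto_log_one_add_div (-q l)).mono_left inf_le_left).const_mul _
  simp only [mul_zero, Finset.sum_const_zero] at h1
  refine h1.congr' ?_
  filter_upwards [eventually_upperInfinity_im_pos] with x hx
  rw [potential_eq_sum_log hκ hq hx]

theorem tendsto_rootProd_div :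
    Tendsto (fun x => rootProd κ q x / x ^ κ) (Bornology.cobounded ℂ) (𝓝 (-1)) := by
  have h1 : Tendsto (fun x : ℂ => -∏ l ∈ Finset.Icc 1 κ, (1 + -q l / x))
      (Bornology.cobounded ℂ) (𝓝 (-∏ l ∈ Finset.Icc 1 κ, (1 + 0))) :=
    (tendsto_finsetProd _ fun l _ => (tendsto_div_cobounded (-q l)).const_add 1).neg
  simp only [add_zero, Finset.prod_const_one] at h1
  refine h1.congr' ?_
  filter_upwards [Bornology.eventually_ne_cobounded (0 : ℂ)] with x hx
  have e : x ^ κ = ∏ l ∈ Finset.Icc 1 κ, x := by simp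
  rw [rootProd, neg_div, e, ← Finset.prod_div_distrib]
  congr 1
  refine Finset.prod_congr rfl fun l _ => ?_
  field_simp
  ring

/-- The real part involves only moduli, so the limit holds in all directions; this serves arbitrary
trajectories and both ends of the real axis. -/
theorem tendsto_potential_re_cobounded (hκ : 2 ≤ κ) (hq : StrictAntiOn q (Set.Icc 1 κ)) :
    Tendsto (fun x => (potential κ q x).re) (Bornology.cobounded ℂ) (𝓝 0) := by
  have h1 : Tendsto (fun x : ℂ => ∑ l ∈ Finset.Icc 1 κ, residueAt κ q l *
      (Complex.log (1 + -q l / x)).re) (Bornology.cobounded ℂ)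
      (𝓝 (∑ l ∈ Finset.Icc 1 κ, residueAt κ q l * (0 : ℂ).re)) :=
    tendsto_finsetSum _ fun l _ =>
      ((Complex.continuous_re.tendsto _).comp (tendsto_log_one_add_div (-q l))).const_mul _
  simp only [Complex.zero_re, mul_zero, Finset.sum_const_zero] at h1
  refine h1.congr' ?_
  have hev : ∀ᶠ x in Bornology.cobounded ℂ, ∀ l ∈ Finset.Icc 1 κ, x ≠ (q l : ℂ) :=
    (Filter.eventually_all_finset _).2 fun l _ => Bornology.eventually_ne_cobounded _
  filter_upwards [Bornology.eventually_ne_cobounded (0 : ℂ), hev] with x hx hx'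
  have h2 : ∀ l ∈ Finset.Icc 1 κ, residueAt κ q l * (Complex.log (1 + -q l / x)).re
      = residueAt κ q l * Real.log ‖x - q l‖ - residueAt κ q l * Real.log ‖x‖ := by
    intro l hl
    have e : 1 + -q l / x = (x - q l) / x := by field_simp; ring
    rw [Complex.log_re, e, norm_div, Real.log_div (norm_ne_zero_iff.2 (sub_ne_zero.2 (hx' l hl)))
      (norm_ne_zero_iff.2 hx)]
    ring
  rw [Finset.sum_congr rfl h2, Finset.sum_sub_distrib, ← Finset.sum_mul, sum_residueAt hκ hq,
    zero_mul, sub_zero, potential_re]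

/-- Since `-QF/x` tends to `1/(κ - 1) > 0`, the quantity `arg (QF) + π - arg x` tends to 0, while
the `κ` logarithms each contribute `arg x + o(1)`. -/
theorem tendsto_logPotential_im_add (hκ : 2 ≤ κ) (hq : StrictAntiOn q (Set.Icc 1 κ)) :
    Tendsto (fun x => (logPotential κ q x).im + ((κ : ℝ) - 1) * x.arg) upperInfinity (𝓝 0) := by
  have h1 : Tendsto (fun x : ℂ => ∑ l ∈ Finset.Icc 1 κ, (Complex.log (1 + -q l / x)).im)
      upperInfinity (𝓝 (∑ l ∈ Finset.Icc 1 κ, (0 : ℂ).im)) :=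
    tendsto_finsetSum _ fun l _ => (Complex.continuous_im.tendsto _).comp
      ((tendsto_log_one_add_div (-q l)).mono_left inf_le_left)
  simp only [Complex.zero_im, Finset.sum_const_zero] at h1
  set c : ℂ := 1 / (κ - 1 : ℕ) with hc
  have hk : (0 : ℝ) < 1 / (κ - 1 : ℕ) := by
    have : (0 : ℝ) < (κ - 1 : ℕ) := by exact_mod_cast (by omega : 0 < κ - 1)
    positivity
  have hcr : c = ((1 / (κ - 1 : ℕ) : ℝ) : ℂ) := by rw [hc]; push_cast; rfl
  have h2 : Tendsto (fun x => -(rootProd κ q x * potential κ q x) / x) upperInfinity (𝓝 c) := by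
    have := ((tendsto_rootProd_div (κ := κ) (q := q)).mono_left inf_le_left).neg.mul
      (tendsto_pow_mul_potential hκ hq)
    rw [neg_neg, one_mul] at this
    refine this.congr' ?_
    filter_upwards [eventually_upperInfinity_im_pos] with x hx
    have hx0 : x ≠ 0 := fun h => by simp [h] at hx
    obtain ⟨n, rfl⟩ : ∃ n, κ = n + 1 := ⟨κ - 1, by omega⟩
    rw [Nat.add_sub_cancel]
    field_simp
    ring
  have h3 : Tendsto (fun x => (Complex.log (-(rootProd κ q x * potential κ q x) / x)).im)
      upperInfinity (𝓝 0) := by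
    have h4 : ContinuousAt Complex.log c := by
      refine continuousAt_clog (Complex.mem_slitPlane_iff.2 (Or.inl ?_))
      rw [hcr, Complex.ofReal_re]; exact hk
    have h5 := (Complex.continuous_im.tendsto _).comp (h4.tendsto.comp h2)
    rwa [hcr, Complex.log_im, Complex.arg_ofReal_of_nonneg hk.le] at h5
  have h6 := h3.sub h1
  rw [sub_zero] at h6
  refine h6.congr' ?_
  filter_upwards [eventually_upperInfinity_im_pos] with x hx
  have hx0 : x ≠ 0 := fun h => by simp [h] at hx
  have hne := Regular.mul_ne_zero hκ hq (Or.inl hx : Regular κ q x)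
  have hneg := Regular.im_neg hκ hq (Or.inl hx : Regular κ q x)
  -- The branches match because `arg (QF) + π` lies in `(0, π)` and `arg x` in `[0, π]`.
  have h7 : Complex.log (-(rootProd κ q x * potential κ q x) / x)
      = Complex.log (rootProd κ q x * potential κ q x) + Real.pi * Complex.I - Complex.log x := by
    have e : -(rootProd κ q x * potential κ q x) / x = Complex.exp
        (Complex.log (rootProd κ q x * potential κ q x) + Real.pi * Complex.I
          - Complex.log x) := by
      rw [Complex.exp_sub, Complex.exp_add, Complex.exp_log hne, Complex.exp_pi_mul_I,
        Complex.exp_log hx0]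
      ring
    have a1 := Complex.neg_pi_lt_arg (rootProd κ q x * potential κ q x)
    have a2 := Complex.arg_neg_iff.2 hneg
    have a3 := Complex.arg_le_pi x
    have a4 : 0 ≤ x.arg := Complex.arg_nonneg_iff.2 hx.le
    rw [e, Complex.log_exp]
    · rw [Complex.sub_im, Complex.add_im, Complex.log_im, Complex.log_im, Complex.im_ofReal_mul,
        Complex.I_im]
      linarith
    · rw [Complex.sub_im, Complex.add_im, Complex.log_im, Complex.log_im, Complex.im_ofReal_mul,
        Complex.I_im]
      linarith
  have h8 : ∑ l ∈ Finset.Icc 1 κ, (logSub (q l) x).im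
      = κ * x.arg + ∑ l ∈ Finset.Icc 1 κ, (Complex.log (1 + -q l / x)).im := by
    simp_rw [logSub_eq_add hx, Complex.add_im]
    rw [Finset.sum_add_distrib, Finset.sum_const, Nat.card_Icc, Nat.add_sub_cancel,
      nsmul_eq_mul, Complex.log_im x]
  rw [h7, logPotential_im, h8, Complex.sub_im, Complex.add_im, Complex.log_im,
    Complex.log_im x, Complex.im_ofReal_mul, Complex.I_im]
  ring

end Infinity

/-! ### The Poincaré hemisphere -/

theorem tendsto_poincareEmbedding {α : Type*} {f : Filter α} {X : α → ℂ} {θ : ℝ}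
    (h1 : Tendsto (fun s => ‖X s‖) f atTop) (h2 : Tendsto (fun s => (X s).arg) f (𝓝 θ)) :
    Tendsto (fun s => poincareEmbedding (X s)) f (𝓝 (Complex.exp (Complex.I * θ), 0)) := by
  have hsq : Tendsto (fun r : ℝ => Real.sqrt (1 + r ^ 2)) atTop atTop :=
    Real.tendsto_sqrt_atTop.comp
      (tendsto_atTop_add_const_left _ _ (tendsto_pow_atTop two_ne_zero))
  have hinv := hsq.inv_tendsto_atTop
  have hone : Tendsto (fun r : ℝ => (Real.sqrt (1 + r ^ 2))⁻¹ * r) atTop (𝓝 1) := by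
    have h3 : Tendsto (fun r : ℝ => Real.sqrt (1 - ((Real.sqrt (1 + r ^ 2))⁻¹) ^ 2)) atTop
        (𝓝 (Real.sqrt (1 - 0 ^ 2))) :=
      (Real.continuous_sqrt.tendsto _).comp ((hinv.pow 2).const_sub 1)
    rw [zero_pow two_ne_zero, sub_zero, Real.sqrt_one] at h3
    refine h3.congr' ?_
    filter_upwards [eventually_ge_atTop 0] with r hr
    have hpos : 0 < 1 + r ^ 2 := by positivity
    rw [inv_pow, Real.sq_sqrt hpos.le, show 1 - (1 + r ^ 2)⁻¹ = r ^ 2 / (1 + r ^ 2) by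
      field_simp; ring, Real.sqrt_div' _ hpos.le, Real.sqrt_sq hr]
    ring
  refine Tendsto.prodMk_nhds ?_ (hinv.comp h1)
  have h4 : Tendsto (fun s => (((Real.sqrt (1 + ‖X s‖ ^ 2))⁻¹ * ‖X s‖ : ℝ) : ℂ) *
      Complex.exp (Complex.I * ((X s).arg : ℝ))) f (𝓝 ((1 : ℝ) * Complex.exp (Complex.I * θ))) := by
    refine ((Complex.continuous_ofReal.tendsto _).comp (hone.comp h1)).mul ?_
    have hc : Continuous fun t : ℝ => Complex.exp (Complex.I * t) := by fun_prop
    exact (hc.tendsto θ).comp h2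
  rw [Complex.ofReal_one, one_mul] at h4
  refine h4.congr fun s => ?_
  have := Complex.norm_mul_exp_arg_mul_I (X s)
  push_cast
  rw [mul_comm Complex.I]
  linear_combination ((Real.sqrt (1 + ‖X s‖ ^ 2) : ℂ))⁻¹ * this

theorem norm_tendsto_atTop_of_poincareEmbedding {α : Type*} {f : Filter α} {X : α → ℂ} {u : ℂ}
    (h : Tendsto (fun s => poincareEmbedding (X s)) f (𝓝 (u, 0))) :
    Tendsto (fun s => ‖X s‖) f atTop := by
  have h1 : Tendsto (fun s => (Real.sqrt (1 + ‖X s‖ ^ 2))⁻¹) f (𝓝 0) :=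
    (continuous_snd.tendsto (u, (0 : ℝ))).comp h
  have h2 : Tendsto (fun s => (Real.sqrt (1 + ‖X s‖ ^ 2))⁻¹) f (𝓝[>] 0) :=
    tendsto_nhdsWithin_iff.2 ⟨h1, Eventually.of_forall fun s =>
      inv_pos.2 (Real.sqrt_pos.2 (by positivity))⟩
  have h3 := tendsto_inv_nhdsGT_zero.comp h2
  have h4 : Tendsto (fun s => Real.sqrt (1 + ‖X s‖ ^ 2) - 1) f atTop :=
    tendsto_atTop_add_const_right _ _ (h3.congr fun s => inv_inv _)
  refine tendsto_atTop_mono (fun s => ?_) h4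
  rw [sub_le_iff_le_add, Real.sqrt_le_left (by positivity)]
  nlinarith [norm_nonneg (X s)]

/-! ### The separatrices -/

section Trajectory

variable {κ : ℕ} {q : ℕ → ℝ}

theorem continuousOn_mk {f g : ℝ → ℝ} {s : Set ℝ} (hf : ContinuousOn f s)
    (hg : ContinuousOn g s) : ContinuousOn (fun t => (⟨f t, g t⟩ : ℂ)) s := by
  simp_rw [Complex.mk_eq_add_mul_I]
  exact (Complex.continuous_ofReal.comp_continuousOn hf).add
    ((Complex.continuous_ofReal.comp_continuousOn hg).mul continuousOn_const)

/-- The `j`-th level curve, parametrized by the height above the real axis. -/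
theorem exists_levelCurve (hκ : 2 ≤ κ) (hq : StrictAntiOn q (Set.Icc 1 κ)) {j : ℕ}
    (h1 : 1 ≤ j) (h2 : j < κ) {p : ℝ} (hp : p ∈ Set.Ioo (q (j + 1)) (q j))
    (h0 : (potential κ q p).re = 0) :
    ∃ w : ℝ → ℝ, w 0 = p ∧ ContinuousOn w (Set.Ici 0) ∧
      ∀ y, 0 ≤ y → Regular κ q ⟨w y, y⟩ ∧ (logPotential κ q ⟨w y, y⟩).im = levelArg j := by
  choose! u hu using fun y (hy : 0 < y) => exists_logPotential_im_eq hκ hq h1 h2 hy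
  have hcell := inCell_of_mem_Ioo hq h1 h2 hp
  set w : ℝ → ℝ := fun y => if 0 < y then u y else p with hw
  have hw0 : w 0 = p := if_neg (lt_irrefl _)
  have hprop : ∀ y, 0 ≤ y → Regular κ q ⟨w y, y⟩ ∧
      (logPotential κ q ⟨w y, y⟩).im = levelArg j := by
    intro y hy
    rcases hy.eq_or_lt with rfl | hy
    · rw [hw0]
      exact ⟨Or.inr ⟨rfl, j, h1, h2, hcell⟩, logPotential_im_of_re_eq_zero hκ hq h1 h2 hcell h0⟩
    · refine ⟨Or.inl hy, ?_⟩
      simp only [hw, if_pos hy]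
      exact hu y hy
  exact ⟨w, hw0, fun y hy => continuousWithinAt_level hκ hq hy (hprop y hy).1
    fun y hy => (hprop y hy).2, hprop⟩

theorem continuousOn_inverse_of_strictMonoOn {S Y : ℝ → ℝ} {J : Set ℝ}
    (hS : StrictMonoOn S (Set.Ici 0)) (hY : ∀ s ∈ J, 0 ≤ Y s ∧ S (Y s) = s) :
    ContinuousOn Y J := by
  intro s₀ hs₀
  rw [Metric.continuousWithinAt_iff']
  intro ε hε
  have h1 : s₀ < S (Y s₀ + ε) := by
    conv_lhs => rw [← (hY s₀ hs₀).2]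
    exact hS (hY s₀ hs₀).1 (Set.mem_Ici.2 (by linarith [(hY s₀ hs₀).1])) (by linarith)
  have h2 : ∀ᶠ s in 𝓝[J] s₀, s ∈ J → Y s₀ - ε < Y s := by
    by_cases h : 0 ≤ Y s₀ - ε
    · have h3 : S (Y s₀ - ε) < s₀ := by
        conv_rhs => rw [← (hY s₀ hs₀).2]
        exact hS h (hY s₀ hs₀).1 (by linarith)
      filter_upwards [nhdsWithin_le_nhds (eventually_gt_nhds h3)] with s hs hsJ
      rw [← (hY s hsJ).2] at hs
      exact (hS.lt_iff_lt h (hY s hsJ).1).1 hs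
    · exact Eventually.of_forall fun s hsJ => by linarith [(hY s hsJ).1]
  filter_upwards [nhdsWithin_le_nhds (eventually_lt_nhds h1), h2, self_mem_nhdsWithin]
    with s hs1 hs2 hsJ
  have := hs2 hsJ
  rw [← (hY s hsJ).2] at hs1
  have h4 := (hS.lt_iff_lt (hY s hsJ).1 (Set.mem_Ici.2 (by linarith [(hY s₀ hs₀).1]))).1 hs1
  rw [Real.dist_eq, abs_lt]
  constructor <;> linarith

/-- By continuity `X` stays near `s` on one local inverse branch of the potential, so it is that
inverse composed with `φ`. -/
theorem hasDerivWithinAt_of_potential (hκ : 2 ≤ κ) (hq : StrictAntiOn q (Set.Icc 1 κ))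
    {X : ℝ → ℂ} {J : Set ℝ} {s : ℝ} {φ : ℝ → ℂ} {φ' : ℂ} (hs : s ∈ J)
    (hX : ContinuousWithinAt X J s) (hreg : OffCuts κ q (X s))
    (hφ : ∀ t ∈ J, potential κ q (X t) = φ t) (hφ' : HasDerivAt φ φ' s) :
    HasDerivWithinAt X (φ' * rootProd κ q (X s)) J s := by
  have hstrict : HasStrictDerivAt (potential κ q) (1 / rootProd κ q (X s)) (X s) := by
    have hopen : ∀ᶠ x in 𝓝 (X s), OffCuts κ q x := by
      refine (Filter.eventually_all_finset _).2 fun l hl => ?_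
      rcases hreg l hl with h | h
      · exact ((Complex.continuous_im.continuousAt.eventually (eventually_gt_nhds h))).mono
          fun _ h => Or.inl h
      · exact (Complex.continuous_re.continuousAt.eventually_ne h).mono fun _ h => Or.inr h
    have han : AnalyticAt ℂ (potential κ q) (X s) :=
      Complex.analyticAt_iff_eventually_differentiableAt.2
        (hopen.mono fun x hx => (hasDerivAt_potential hκ hq hx).differentiableAt)
    have := han.hasStrictDerivAt
    rwa [(hasDerivAt_potential hκ hq hreg).deriv] at this
  have hne : 1 / rootProd κ q (X s) ≠ 0 := one_div_ne_zero hreg.rootProd_ne_zero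
  have hinv := (hstrict.to_localInverse hne).hasDerivAt
  have hleft := hstrict.eventually_left_inverse hne
  have hcomp : HasDerivWithinAt (fun t => hstrict.localInverse _ _ _ hne (φ t))
      (φ' * rootProd κ q (X s)) J s := by
    have h1 : HasDerivAt (hstrict.localInverse _ _ _ hne) (1 / rootProd κ q (X s))⁻¹ (φ s) := by
      rwa [hφ s hs] at hinv
    have h2 := (h1.comp_of_eq s hφ' rfl).hasDerivWithinAt (s := J)
    refine h2.congr_deriv ?_
    rw [one_div, inv_inv, mul_comm]
  have hev : ∀ᶠ t in 𝓝[J] s, hstrict.localInverse _ _ _ hne (φ t) = X t := by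
    filter_upwards [hX.eventually hleft, self_mem_nhdsWithin] with t ht htJ
    rw [← hφ t htJ, ht]
  refine hcomp.congr_of_eventuallyEq (hev.mono fun t ht => ht.symm) ?_
  have := hleft.self_of_nhds
  rw [hφ s hs] at this
  exact this.symm

/-- Along the `j`-th separatrix, traversed upwards from the real axis, the flow reaches the `j`-th
saddle at infinity in the finite time `π |∑ l ≤ j, 1 / Q'(q l)|`. -/
theorem exists_trajectory (hκ : 2 ≤ κ) (hq : StrictAntiOn q (Set.Icc 1 κ)) {j : ℕ}
    (h1 : 1 ≤ j) (h2 : j < κ) {p : ℝ} (hp : p ∈ Set.Ioo (q (j + 1)) (q j))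
    (h0 : (potential κ q p).re = 0) {T : ℝ} (hT : T = (-1) ^ j * residueSum κ q j * Real.pi) :
    ∃ X : ℝ → ℂ, X 0 = p ∧
      (∀ s ∈ Set.Ico 0 T, HasDerivWithinAt X (-(-1) ^ j * (Complex.I * rootProd κ q (X s)))
        (Set.Ico 0 T) s) ∧
      Tendsto (fun s => ‖X s‖) (𝓝[<] T) atTop ∧
      Tendsto (fun s => poincareEmbedding (X s)) (𝓝[<] T) (𝓝 (equatorSaddle κ j)) := by
  have hTpos : 0 < T := by
    rw [hT]; exact mul_pos (residueSum_pos hq h1 h2) Real.pi_pos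
  obtain ⟨w, hw0, hwc, hw⟩ := exists_levelCurve hκ hq h1 h2 hp h0
  set γ : ℝ → ℂ := fun y => ⟨w y, y⟩ with hγ
  have hγc : ContinuousOn γ (Set.Ici 0) := continuousOn_mk hwc continuousOn_id
  -- The elapsed time at height `y`: `|F|` equals `T` at `p` and must decrease at unit speed.
  set S : ℝ → ℝ := fun y => T - ‖potential κ q (γ y)‖ with hS
  have hγ0 : γ 0 = p := by rw [hγ]; simp only [hw0]; rfl
  have hS0 : S 0 = 0 := by
    have him := potential_im_of_inCell (κ := κ) (q := q) (x := (p : ℂ)) (Complex.ofReal_im p)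
      (by simpa using inCell_of_mem_Ioo hq h1 h2 hp) h2.le
    have e : potential κ q p = ((Real.pi * residueSum κ q j : ℝ) : ℂ) * Complex.I := by
      apply Complex.ext
      · simp [h0]
      · simp [him]
    have hpos := residueSum_pos hq h1 h2
    have habs : |residueSum κ q j| = (-1) ^ j * residueSum κ q j := by
      rw [← abs_of_pos hpos, abs_mul]; simp
    simp only [hS, hγ0, e]
    rw [norm_mul, Complex.norm_I, mul_one, Complex.norm_real, Real.norm_eq_abs, abs_mul, habs,
      abs_of_pos Real.pi_pos, hT]
    ring
  have hSmono : StrictMonoOn S (Set.Ici 0) := by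
    intro y₁ hy₁ y₂ hy₂ hlt
    have := norm_potential_lt hκ hq (x := γ y₁) (y := γ y₂) (hw y₁ hy₁).1 hlt hy₁
      ((hw y₁ hy₁).2.trans (hw y₂ hy₂).2.symm)
    simp only [hS]
    linarith
  have hScont : ContinuousOn S (Set.Ici 0) := by
    intro y hy
    have h3 := (hasDerivAt_potential hκ hq (hw y hy).1.offCuts).continuousAt
    exact (ContinuousAt.comp_continuousWithinAt (f := γ) h3 (hγc y hy)).norm.const_sub T
  have hnorm : ∀ z : ℂ, 0 ≤ z.im → z.im ≤ ‖z‖ := fun z hz =>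
    (le_abs_self _).trans (Complex.abs_im_le_norm z)
  have hγinf : Tendsto γ atTop upperInfinity := by
    refine tendsto_inf.2 ⟨?_, ?_⟩
    · rw [← tendsto_norm_atTop_iff_cobounded]
      exact tendsto_atTop_mono' _ ((eventually_ge_atTop 0).mono fun y hy => hnorm (γ y) hy)
        tendsto_id
    · exact tendsto_principal.2 (eventually_gt_atTop 0)
  have hSlim : Tendsto S atTop (𝓝 T) := by
    simpa using ((tendsto_potential_zero hκ hq).comp hγinf).norm.const_sub T
  have hSlt : ∀ y, 0 ≤ y → S y < T := fun y hy => by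
    have := right_ne_zero_of_mul ((hw y hy).1.mul_ne_zero hκ hq)
    have := norm_pos_iff.2 this
    simp only [hS]; linarith
  have hex : ∀ s ∈ Set.Ico 0 T, ∃ y, 0 ≤ y ∧ S y = s := by
    intro s hs
    obtain ⟨b, hb, hb0⟩ := ((hSlim.eventually (eventually_gt_nhds hs.2)).and
      (eventually_ge_atTop 0)).exists
    obtain ⟨y, hy, hy'⟩ := intermediate_value_Icc hb0 (hScont.mono Set.Icc_subset_Ici_self)
      (⟨by rw [hS0]; exact hs.1, hb.le⟩ : s ∈ Set.Icc (S 0) (S b))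
    exact ⟨y, hy.1, hy'⟩
  choose! Y hY using hex
  have hYc : ContinuousOn Y (Set.Ico 0 T) := continuousOn_inverse_of_strictMonoOn hSmono hY
  have hY0 : Y 0 = 0 := by
    have := hY 0 ⟨le_rfl, hTpos⟩
    exact hSmono.injOn this.1 (Set.mem_Ici.2 le_rfl) (this.2.trans hS0.symm)
  have hYlim : Tendsto Y (𝓝[<] T) atTop := by
    refine tendsto_atTop.2 fun M => ?_
    have hM : 0 ≤ max M 0 := le_max_right _ _
    filter_upwards [Ioo_mem_nhdsLT (hSlt _ hM), Ioo_mem_nhdsLT hTpos] with s hs hs'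
    have hs'' := hY s ⟨hs'.1.le, hs'.2⟩
    have hlt : S (max M 0) < S (Y s) := by rw [hs''.2]; exact hs.1
    exact (le_max_left M 0).trans ((hSmono.lt_iff_lt hM hs''.1).1 hlt).le
  have hpot : ∀ s ∈ Set.Ico 0 T, potential κ q (γ (Y s))
      = ((T - s : ℝ) : ℂ) * (Complex.I * (-1) ^ j) := by
    intro s hs
    have h3 := hw (Y s) (hY s hs).1
    rw [h3.1.potential_eq_of_level hκ hq h3.2]
    congr 2
    have := (hY s hs).2
    simp only [hS] at this
    linarith
  have hlim : Tendsto (fun s => γ (Y s)) (𝓝[<] T) upperInfinity := hγinf.comp hYlim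
  have hnlim : Tendsto (fun s => ‖γ (Y s)‖) (𝓝[<] T) atTop :=
    tendsto_norm_atTop_iff_cobounded.2 (hlim.mono_right inf_le_left)
  have harg : Tendsto (fun s => (γ (Y s)).arg) (𝓝[<] T) (𝓝
      (Real.pi / ((κ : ℝ) - 1) * ((j : ℝ) - 1) + Real.pi / (2 * ((κ : ℝ) - 1)))) := by
    have hk : (0 : ℝ) < (κ : ℝ) - 1 := by
      have : (2 : ℝ) ≤ κ := by exact_mod_cast hκ
      linarith
    have h3 := ((tendsto_logPotential_im_add hκ hq).comp hlim).sub_const (levelArg j)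
    have h4 := h3.div_const ((κ : ℝ) - 1)
    -- Along the curve `-(κ - 1) arg x` tends to `levelArg j`, which determines the saddle.
    have e : (0 - levelArg j) / ((κ : ℝ) - 1)
        = Real.pi / ((κ : ℝ) - 1) * ((j : ℝ) - 1) + Real.pi / (2 * ((κ : ℝ) - 1)) := by
      rw [levelArg]; field_simp; ring
    rw [e] at h4
    refine h4.congr' ?_
    filter_upwards [Ioo_mem_nhdsLT hTpos] with s hs
    have h5 := (hw (Y s) (hY s ⟨hs.1.le, hs.2⟩).1).2
    simp only [Function.comp]
    rw [show logPotential κ q (γ (Y s)) = logPotential κ q ⟨w (Y s), Y s⟩ from rfl, h5]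
    field_simp
    ring
  refine ⟨fun s => γ (Y s), by simp only [hY0, hγ0], fun s hs => ?_, hnlim,
    tendsto_poincareEmbedding hnlim harg⟩
  have hφ : HasDerivAt (fun s : ℝ => ((T - s : ℝ) : ℂ) * (Complex.I * (-1) ^ j))
      (-(Complex.I * (-1) ^ j)) s := by
    have h3 := (((hasDerivAt_id s).const_sub T).ofReal_comp).mul_const (Complex.I * (-1 : ℂ) ^ j)
    refine h3.congr_deriv ?_
    push_cast
    ring
  have h4 := hasDerivWithinAt_of_potential hκ hq (X := fun s => γ (Y s)) hs
    ((hγc.comp hYc fun s hs => (hY s hs).1) s hs) (hw _ (hY s hs).1).1.offCuts hpot hφ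
  refine h4.congr_deriv ?_
  ring

end Trajectory

/-! ### Forward solutions -/

/-- The filter of times tending to the end `ω` of the time interval. -/
def endFilter (ω : EReal) : Filter ℝ := comap (fun s : ℝ => (s : EReal)) (𝓝[<] ω)

theorem endFilter_coe (T : ℝ) : endFilter (T : EReal) = 𝓝[<] T := by
  rw [endFilter, nhdsWithin, comap_inf, comap_principal, ← EReal.isEmbedding_coe.nhds_eq_comap,
    nhdsWithin]
  congr 2
  ext s
  simp

theorem forwardInterval_coe (T : ℝ) : forwardInterval (T : EReal) = Set.Ico 0 T := by
  ext s; simp [forwardInterval]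

theorem eventually_mem_forwardInterval {ω : EReal} (h : 0 < ω) :
    ∀ᶠ s in endFilter ω, s ∈ forwardInterval ω := by
  have h1 : (fun s : ℝ => (s : EReal)) ⁻¹' Set.Ioo 0 ω ∈ endFilter ω :=
    preimage_mem_comap (Ioo_mem_nhdsLT h)
  filter_upwards [h1] with s hs
  exact ⟨EReal.coe_nonneg.1 hs.1.le, hs.2⟩

theorem endFilter_neBot {ω : EReal} (h : 0 < ω) : (endFilter ω).NeBot := by
  refine comap_neBot fun t ht => ?_
  obtain ⟨a, ha, hat⟩ := (mem_nhdsLT_iff_exists_Ioo_subset' h).1 ht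
  obtain ⟨r, h1, h2⟩ := EReal.lt_iff_exists_real_btwn.1 ha
  exact ⟨r, hat ⟨h1, h2⟩⟩

theorem forwardInterval_mem_nhdsGE {ω : EReal} {s : ℝ} (hs : s ∈ forwardInterval ω) :
    forwardInterval ω ∈ 𝓝[≥] s := by
  obtain ⟨r, h1, h2⟩ := EReal.lt_iff_exists_real_btwn.1 hs.2
  have h1' : s < r := by exact_mod_cast h1
  filter_upwards [Ico_mem_nhdsGE h1'] with t ht
  exact ⟨hs.1.trans ht.1, lt_trans (by exact_mod_cast ht.2) h2⟩

theorem Icc_subset_forwardInterval {ω : EReal} {s : ℝ} (hs : s ∈ forwardInterval ω) :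
    Set.Icc 0 s ⊆ forwardInterval ω := fun _ ht =>
  ⟨ht.1, lt_of_le_of_lt (by exact_mod_cast ht.2) hs.2⟩

section ForwardSolution

variable {f : ℂ → ℂ} {z : ℂ} {ω : EReal} {x : ℝ → ℂ}

theorem IsForwardSolution.continuousOn (h : IsForwardSolution f z ω x) :
    ContinuousOn x (forwardInterval ω) := fun s hs => (h.deriv s hs).continuousWithinAt

theorem IsForwardSolution.hasDerivWithinAt_Ici (h : IsForwardSolution f z ω x) {s : ℝ}
    (hs : s ∈ forwardInterval ω) : HasDerivWithinAt x (f (x s)) (Set.Ici s) s :=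
  (h.deriv s hs).mono_of_mem_nhdsWithin (forwardInterval_mem_nhdsGE hs)

theorem exists_lipschitzOnWith_of_continuousOn (hf : ContDiff ℝ 1 f) {x y : ℝ → ℂ} {a b : ℝ}
    (hx : ContinuousOn x (Set.Icc a b)) (hy : ContinuousOn y (Set.Icc a b)) :
    ∃ K, LipschitzOnWith K f (x '' Set.Icc a b ∪ y '' Set.Icc a b) :=
  hf.locallyLipschitz.locallyLipschitzOn.exists_lipschitzOnWith_of_compact
    ((isCompact_Icc.image_of_continuousOn hx).union (isCompact_Icc.image_of_continuousOn hy))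

theorem IsForwardSolution.eqOn (hf : ContDiff ℝ 1 f) {ω' : EReal} {y : ℝ → ℂ}
    (hx : IsForwardSolution f z ω x) (hy : IsForwardSolution f z ω' y) {s : ℝ}
    (hs : s ∈ forwardInterval ω) (hs' : s ∈ forwardInterval ω') : x s = y s := by
  have hxc := hx.continuousOn.mono (Icc_subset_forwardInterval hs)
  have hyc := hy.continuousOn.mono (Icc_subset_forwardInterval hs')
  obtain ⟨K, hK⟩ := exists_lipschitzOnWith_of_continuousOn hf hxc hyc
  refine ODE_solution_unique_of_mem_Icc_right (v := fun _ => f)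
    (s := fun _ => x '' Set.Icc 0 s ∪ y '' Set.Icc 0 s) (K := K) (fun _ _ => hK) hxc ?_ ?_ hyc
    ?_ ?_ (hx.init.trans hy.init.symm) ⟨hs.1, le_rfl⟩
  · exact fun t ht => hx.hasDerivWithinAt_Ici
      (Icc_subset_forwardInterval hs (Set.Ico_subset_Icc_self ht))
  · exact fun t ht => Or.inl ⟨t, Set.Ico_subset_Icc_self ht, rfl⟩
  · exact fun t ht => hy.hasDerivWithinAt_Ici
      (Icc_subset_forwardInterval hs' (Set.Ico_subset_Icc_self ht))
  · exact fun t ht => Or.inr ⟨t, Set.Ico_subset_Icc_self ht, rfl⟩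

/-- Backward uniqueness against the constant solution at the equilibrium. -/
theorem IsForwardSolution.eq_of_hits_zero (hf : ContDiff ℝ 1 f) (hx : IsForwardSolution f z ω x)
    {s : ℝ} (hs : s ∈ forwardInterval ω) (h0 : f (x s) = 0) : z = x s := by
  have hsub := Icc_subset_forwardInterval hs
  have hxc := hx.continuousOn.mono hsub
  have hyc : ContinuousOn (fun _ : ℝ => x s) (Set.Icc 0 s) := continuousOn_const
  obtain ⟨K, hK⟩ := exists_lipschitzOnWith_of_continuousOn hf hxc hyc
  have hsx : ∀ t ∈ Set.Ioc 0 s, forwardInterval ω ∈ 𝓝[≤] t := fun t ht => by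
    filter_upwards [Ioc_mem_nhdsLE ht.1] with r hr
    exact hsub ⟨hr.1.le, hr.2.trans ht.2⟩
  have := ODE_solution_unique_of_mem_Icc_left (v := fun _ => f)
    (s := fun _ => x '' Set.Icc 0 s ∪ (fun _ : ℝ => x s) '' Set.Icc 0 s) (K := K)
    (fun _ _ => hK) hxc
    (fun t ht => (hx.deriv t (hsub (Set.Ioc_subset_Icc_self ht))).mono_of_mem_nhdsWithin
      (hsx t ht))
    (fun t ht => Or.inl ⟨t, Set.Ioc_subset_Icc_self ht, rfl⟩) hyc
    (fun t ht => by simpa only [h0] using hasDerivWithinAt_const t (Set.Iic t) (x s))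
    (fun t ht => Or.inr ⟨t, Set.Ioc_subset_Icc_self ht, rfl⟩) rfl (Set.left_mem_Icc.2 hs.1)
  rw [← hx.init]
  exact this

theorem isForwardSolution_const (h0 : f z = 0) : IsForwardSolution f z ⊤ fun _ => z :=
  ⟨EReal.zero_lt_top, rfl, fun s _ => by simpa only [h0] using hasDerivWithinAt_const s _ z⟩

theorem IsForwardSolution.ne_zero_of_blowup (hf : ContDiff ℝ 1 f)
    (hx : IsForwardSolution f z ω x) (hinf : Tendsto (fun s => ‖x s‖) (endFilter ω) atTop)
    {s : ℝ} (hs : s ∈ forwardInterval ω) : f (x s) ≠ 0 := by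
  intro h0
  have hz : f z = 0 := by rw [hx.eq_of_hits_zero hf hs h0]; exact h0
  have := endFilter_neBot hx.pos
  obtain ⟨t, ht, ht'⟩ := ((hinf.eventually_gt_atTop ‖z‖).and
    (eventually_mem_forwardInterval hx.pos)).exists
  rw [hx.eqOn hf (isForwardSolution_const hz) ht' ⟨ht'.1, EReal.coe_lt_top t⟩] at ht
  exact lt_irrefl _ ht

/-- A solution existing beyond `ω` would be bounded near `ω`, yet it agrees with `x` there. -/
theorem IsForwardSolution.le_of_blowup (hf : ContDiff ℝ 1 f) {ω' : EReal} {y : ℝ → ℂ}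
    (hx : IsForwardSolution f z ω x) (hy : IsForwardSolution f z ω' y)
    (hinf : Tendsto (fun s => ‖x s‖) (endFilter ω) atTop) : ω' ≤ ω := by
  by_contra hlt
  rw [not_le] at hlt
  have hpos := hx.pos
  obtain ⟨r, rfl⟩ : ∃ r : ℝ, ω = r := by
    refine ⟨ω.toReal, (EReal.coe_toReal hlt.ne_top ?_).symm⟩
    exact (bot_le.trans_lt hpos).ne'
  have hr0 : 0 < r := by exact_mod_cast hpos
  have hr : r ∈ forwardInterval ω' := ⟨hr0.le, hlt⟩
  rw [endFilter_coe] at hinf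
  have hc : Tendsto (fun s => ‖y s‖) (𝓝[<] r) (𝓝 ‖y r‖) := by
    have h1 := (hy.continuousOn r hr).norm
    refine h1.mono_left (nhdsWithin_le_iff.2 ?_)
    filter_upwards [Ioo_mem_nhdsLT hr0] with s hs
    exact Icc_subset_forwardInterval hr ⟨hs.1.le, hs.2.le⟩
  refine not_tendsto_nhds_of_tendsto_atTop hinf _ (hc.congr' ?_)
  filter_upwards [Ioo_mem_nhdsLT hr0] with s hs
  refine (congrArg norm (hx.eqOn hf hy ?_ ?_)).symm
  · rw [forwardInterval_coe]; exact ⟨hs.1.le, hs.2⟩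
  · exact Icc_subset_forwardInterval hr ⟨hs.1.le, hs.2.le⟩

theorem IsForwardSolution.limit_unique (hf : ContDiff ℝ 1 f) {ω' : EReal} {y : ℝ → ℂ}
    (hx : IsForwardSolution f z ω x) (hy : IsForwardSolution f z ω' y) {u v : ℂ}
    (hxu : Tendsto (fun s => poincareEmbedding (x s)) (endFilter ω) (𝓝 (u, 0)))
    (hyv : Tendsto (fun s => poincareEmbedding (y s)) (endFilter ω') (𝓝 (v, 0))) : u = v := by
  have e : ω = ω' := le_antisymm
    (hy.le_of_blowup hf hx (norm_tendsto_atTop_of_poincareEmbedding hyv))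
    (hx.le_of_blowup hf hy (norm_tendsto_atTop_of_poincareEmbedding hxu))
  subst e
  have := endFilter_neBot hx.pos
  have h1 := hxu.congr' ((eventually_mem_forwardInterval hx.pos).mono fun s hs =>
    congrArg poincareEmbedding (hx.eqOn hf hy hs hs))
  exact congrArg Prod.fst (tendsto_nhds_unique h1 hyv)

end ForwardSolution

/-- Normalizing by the value at `s` puts the argument of the logarithm at 1, away from any branch
cut. -/
theorem hasDerivWithinAt_log_norm_sub {x : ℝ → ℂ} {x' a : ℂ} {J : Set ℝ} {s : ℝ}
    (hx : HasDerivWithinAt x x' J s) (ha : x s - a ≠ 0) :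
    HasDerivWithinAt (fun t => Real.log ‖x t - a‖) (x' / (x s - a)).re J s := by
  have h1 : HasDerivWithinAt (fun t => (x t - a) / (x s - a)) (x' / (x s - a)) J s :=
    (hx.sub_const a).div_const _
  have h2 := h1.clog_real (by rw [div_self ha]; exact Complex.one_mem_slitPlane)
  have h3 := (Complex.reCLM.hasFDerivAt.comp_hasDerivWithinAt s h2).add_const
    (Real.log ‖x s - a‖)
  rw [div_self ha, div_one] at h3
  have hev : ∀ᶠ t in 𝓝[J] s, x t - a ≠ 0 :=
    (hx.continuousWithinAt.sub continuousWithinAt_const).eventually_ne ha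
  refine (h3.congr_of_eventuallyEq ?_ ?_)
  · filter_upwards [hev] with t ht
    simp only [Function.comp, Complex.reCLM_apply, Complex.log_re, norm_div]
    rw [Real.log_div (norm_ne_zero_iff.2 ht) (norm_ne_zero_iff.2 ha)]
    ring
  · simp [div_self ha]

/-! ### The flow `x' = ± i Q(x)` -/

/-- The field `x ↦ i Q(x)`, reversed for even `j`. -/
def signedField (κ : ℕ) (q : ℕ → ℝ) (j : ℕ) (x : ℂ) : ℂ :=
  -(-1) ^ j * (Complex.I * rootProd κ q x)

section Flow

variable {κ : ℕ} {q : ℕ → ℝ}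

theorem contDiff_signedField (j : ℕ) : ContDiff ℝ 1 (signedField κ q j) := by
  unfold signedField rootProd
  fun_prop

theorem signedField_ne_zero {j : ℕ} {x : ℂ} (h : signedField κ q j x ≠ 0) :
    ∀ l ∈ Finset.Icc 1 κ, x - q l ≠ 0 :=
  rootProd_ne_zero_iff.1 (right_ne_zero_of_mul (right_ne_zero_of_mul h))

theorem rootProd_conj (x : ℂ) :
    rootProd κ q (starRingEnd ℂ x) = starRingEnd ℂ (rootProd κ q x) := by
  simp [rootProd, map_prod]

/-- `Q` has real coefficients, so conjugation only changes the sign of `i`, that is, reverses time.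
-/
theorem IsForwardSolution.conj {j m : ℕ} (hjm : (-1 : ℂ) ^ j = -(-1) ^ m) {z : ℂ} {ω : EReal}
    {x : ℝ → ℂ} (hx : IsForwardSolution (signedField κ q m) z ω x) :
    IsForwardSolution (signedField κ q j) (starRingEnd ℂ z) ω
      (fun s => starRingEnd ℂ (x s)) := by
  refine ⟨hx.pos, by rw [hx.init], fun s hs => ?_⟩
  refine (hx.deriv s hs).star.congr_deriv ?_
  simp only [signedField, ← starRingEnd_apply, map_mul, map_neg, map_pow, map_one, Complex.conj_I,
    rootProd_conj, hjm]
  ring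

theorem poincareEmbedding_conj_tendsto {α : Type*} {g : Filter α} {X : α → ℂ} {u : ℂ}
    (h : Tendsto (fun s => poincareEmbedding (X s)) g (𝓝 (u, 0))) :
    Tendsto (fun s => poincareEmbedding (starRingEnd ℂ (X s))) g
      (𝓝 (starRingEnd ℂ u, 0)) := by
  have hc : Continuous fun p : ℂ × ℝ => (starRingEnd ℂ p.1, p.2) := by fun_prop
  refine ((hc.tendsto _).comp h).congr fun s => ?_
  simp [poincareEmbedding]

/-- The real part of the potential is conserved by the flow. -/
theorem potential_re_eq_zero_of_blowup (hκ : 2 ≤ κ) (hq : StrictAntiOn q (Set.Icc 1 κ)) {j : ℕ}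
    {z : ℂ} {ω : EReal} {x : ℝ → ℂ} (hx : IsForwardSolution (signedField κ q j) z ω x)
    (hinf : Tendsto (fun s => ‖x s‖) (endFilter ω) atTop) : (potential κ q z).re = 0 := by
  have hd : ∀ s ∈ forwardInterval ω,
      HasDerivWithinAt (fun t => (potential κ q (x t)).re) 0 (forwardInterval ω) s := by
    intro s hs
    have hne := hx.ne_zero_of_blowup (contDiff_signedField j) hinf hs
    have hne' := signedField_ne_zero hne
    -- A general trajectory may cross the cuts of the potential, so its real part is differentiated
    -- through the moduli.
    have h1 : HasDerivWithinAt (fun t => ∑ l ∈ Finset.Icc 1 κ,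
        residueAt κ q l * Real.log ‖x t - q l‖) _ (forwardInterval ω) s :=
      HasDerivWithinAt.fun_sum fun l hl =>
        (hasDerivWithinAt_log_norm_sub (hx.deriv s hs) (hne' l hl)).const_mul (residueAt κ q l)
    simp_rw [potential_re]
    refine h1.congr_deriv ?_
    have h2 : ∑ l ∈ Finset.Icc 1 κ,
        residueAt κ q l * (signedField κ q j (x s) / (x s - q l)).re
        = (signedField κ q j (x s) * (1 / rootProd κ q (x s))).re := by
      rw [← sum_residueAt_div hκ hq hne', Finset.mul_sum, Complex.re_sum]
      refine Finset.sum_congr rfl fun l _ => ?_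
      rw [← Complex.re_ofReal_mul]
      congr 1
      ring
    have h3 := rootProd_ne_zero_iff.2 hne'
    rw [h2, signedField]
    have e : -(-1) ^ j * (Complex.I * rootProd κ q (x s)) * (1 / rootProd κ q (x s))
        = ((-(-1) ^ j : ℝ) : ℂ) * Complex.I := by
      push_cast
      field_simp
    rw [e, Complex.re_ofReal_mul, Complex.I_re, mul_zero]
  have hconst : ∀ s ∈ forwardInterval ω, (potential κ q (x s)).re = (potential κ q z).re := by
    intro s hs
    have hsub := Icc_subset_forwardInterval hs
    have := constant_of_has_deriv_right_zero (f := fun t => (potential κ q (x t)).re)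
      (a := 0) (b := s) (fun t ht => ((hd t (hsub ht)).continuousWithinAt).mono hsub)
      (fun t ht => (hd t (hsub (Set.Ico_subset_Icc_self ht))).mono_of_mem_nhdsWithin
        (forwardInterval_mem_nhdsGE (hsub (Set.Ico_subset_Icc_self ht)))) s ⟨hs.1, le_rfl⟩
    simp only [hx.init] at this
    exact this
  have := endFilter_neBot hx.pos
  have h1 : Tendsto (fun s => (potential κ q (x s)).re) (endFilter ω) (𝓝 0) :=
    (tendsto_potential_re_cobounded hκ hq).comp (tendsto_norm_atTop_iff_cobounded.1 hinf)
  have h2 := h1.congr' ((eventually_mem_forwardInterval hx.pos).mono hconst)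
  exact tendsto_nhds_unique tendsto_const_nhds h2

/-! ### Real points on the stable manifolds -/

theorem exists_inCell (hq : StrictAntiOn q (Set.Icc 1 κ)) {t : ℝ}
    (ht : ∀ l ∈ Finset.Icc 1 κ, t ≠ q l) : ∃ m ≤ κ, InCell κ q m t := by
  classical
  -- Index 0 is a sentinel for a point to the right of all roots.
  set P : ℕ → Prop := fun l => l = 0 ∨ t < q l with hP
  have hm := Nat.findGreatest_spec (P := P) (Nat.zero_le κ) (Or.inl rfl)
  refine ⟨Nat.findGreatest P κ, Nat.findGreatest_le κ, fun l hl => ⟨fun h => ?_, fun h => ?_⟩⟩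
  · rw [Finset.mem_Icc] at hl
    rcases hm with h0 | h0
    · omega
    · exact h0.trans_le (hq.antitoneOn ⟨hl.1, hl.2⟩ ⟨by omega, Nat.findGreatest_le κ⟩ h)
  · have h1 := Nat.findGreatest_is_greatest h (Finset.mem_Icc.1 hl).2
    simp only [hP, not_or, not_lt] at h1
    exact lt_of_le_of_ne h1.2 (ht l hl).symm

/-- On the real axis `Re F` has derivative `1/Q`, whose sign on this interval is `-(-1)^m`. -/
theorem strictAntiOn_potential_re (hκ : 2 ≤ κ) (hq : StrictAntiOn q (Set.Icc 1 κ)) {m : ℕ}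
    (hm : m ≤ κ) :
    StrictAntiOn (fun t : ℝ => (-1) ^ m * (potential κ q t).re) {t | InCell κ q m t} := by
  have hconv : Convex ℝ {t | InCell κ q m t} := by
    refine Set.OrdConnected.convex ⟨fun a ha b hb t ht l hl => ⟨fun h => ?_, fun h => ?_⟩⟩
    · exact ht.2.trans_lt ((hb l hl).1 h)
    · exact ((ha l hl).2 h).trans_le ht.1
  have hd : ∀ t, InCell κ q m t → HasDerivAt (fun t : ℝ => (-1) ^ m * (potential κ q t).re)
      ((-1) ^ m * (1 / rootProd κ q t).re) t := by
    intro t ht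
    have hoff : OffCuts κ q t := fun l hl => Or.inr (by simpa using ht.ne hl)
    exact ((hasDerivAt_potential hκ hq hoff).real_of_complex).const_mul _
  refine strictAntiOn_of_deriv_neg hconv
    (fun t ht => (hd t ht).continuousAt.continuousWithinAt) fun t ht => ?_
  have ht' : InCell κ q m t := interior_subset ht
  have hpos := ht'.prod_pos hm
  have e : (1 / rootProd κ q t).re = -(∏ l ∈ Finset.Icc 1 κ, (t - q l))⁻¹ := by
    rw [rootProd_ofReal, ← Complex.ofReal_one, ← Complex.ofReal_div, Complex.ofReal_re, one_div,
      inv_neg]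
  have e2 : (-1 : ℝ) ^ m = ((-1) ^ m)⁻¹ := by rw [← inv_pow]; norm_num
  rw [(hd t ht').deriv, e, mul_neg, neg_lt_zero, e2, ← mul_inv]
  exact inv_pos.2 hpos

theorem tendsto_ofReal_cobounded_atTop :
    Tendsto (fun t : ℝ => (t : ℂ)) atTop (Bornology.cobounded ℂ) := by
  rw [← tendsto_norm_atTop_iff_cobounded]
  simpa using tendsto_abs_atTop_atTop

theorem tendsto_ofReal_cobounded_atBot :
    Tendsto (fun t : ℝ => (t : ℂ)) atBot (Bornology.cobounded ℂ) := by
  rw [← tendsto_norm_atTop_iff_cobounded]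
  simpa using tendsto_abs_atBot_atTop

/-- The real part of the potential does not vanish on the unbounded intervals. -/
theorem cell_bounded_of_potential_re_eq_zero (hκ : 2 ≤ κ) (hq : StrictAntiOn q (Set.Icc 1 κ))
    {m : ℕ} (hm : m ≤ κ) {t : ℝ} (ht : InCell κ q m t) (h0 : (potential κ q t).re = 0) :
    1 ≤ m ∧ m < κ := by
  have hanti := strictAntiOn_potential_re hκ hq hm
  constructor
  · by_contra h
    obtain rfl : m = 0 := by omega
    have hcell : ∀ r, t ≤ r → InCell κ q 0 r := fun r hr l hl =>
      ⟨fun h => by have := (Finset.mem_Icc.1 hl).1; omega,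
        fun h => ((ht l hl).2 h).trans_le hr⟩
    have h1 := hanti ht (hcell (t + 1) (by linarith)) (by linarith)
    have hlim := ((tendsto_potential_re_cobounded hκ hq).comp
      tendsto_ofReal_cobounded_atTop).const_mul ((-1 : ℝ) ^ 0)
    rw [mul_zero] at hlim
    have h2 := le_of_tendsto hlim ((eventually_ge_atTop (t + 1)).mono fun r hr =>
      hanti.antitoneOn (hcell (t + 1) (by linarith)) (hcell r (by linarith)) hr)
    simp only [h0, mul_zero] at h1
    exact absurd h1 (not_lt.2 h2)
  · by_contra h
    obtain rfl : m = κ := by omega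
    have hcell : ∀ r, r ≤ t → InCell m q m r := fun r hr l hl =>
      ⟨fun h => hr.trans_lt ((ht l hl).1 h),
        fun h => by have := (Finset.mem_Icc.1 hl).2; omega⟩
    have h1 := hanti (hcell (t - 1) (by linarith)) ht (by linarith)
    have hlim := ((tendsto_potential_re_cobounded hκ hq).comp
      tendsto_ofReal_cobounded_atBot).const_mul ((-1 : ℝ) ^ m)
    rw [mul_zero] at hlim
    have h2 := ge_of_tendsto hlim ((eventually_le_atBot (t - 1)).mono fun r hr =>
      hanti.antitoneOn (hcell r (by linarith)) (hcell (t - 1) (by linarith)) hr)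
    simp only [h0, mul_zero] at h1
    exact absurd h1 (not_lt.2 h2)

theorem isForwardSolution_coe {f : ℂ → ℂ} {z : ℂ} {T : ℝ} {x : ℝ → ℂ} (hT : 0 < T)
    (h0 : x 0 = z) (hx : ∀ s ∈ Set.Ico 0 T, HasDerivWithinAt x (f (x s)) (Set.Ico 0 T) s) :
    IsForwardSolution f z (T : EReal) x := by
  refine ⟨by exact_mod_cast hT, h0, ?_⟩
  rw [forwardInterval_coe]
  exact hx

/-- The angle of the `j`-th saddle at infinity. -/
def saddleAngle (κ j : ℕ) : ℝ :=
  Real.pi / ((κ : ℝ) - 1) * ((j : ℝ) - 1) + Real.pi / (2 * ((κ : ℝ) - 1))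

theorem equatorSaddle_eq (κ j : ℕ) :
    equatorSaddle κ j = (Complex.exp (saddleAngle κ j * Complex.I), 0) := by
  rw [equatorSaddle, mul_comm]; rfl

theorem saddleAngle_mem (hκ : 2 ≤ κ) {j : ℕ} (h1 : 1 ≤ j) (h2 : j < κ) :
    saddleAngle κ j ∈ Set.Ioo 0 Real.pi := by
  have hk : (0 : ℝ) < (κ : ℝ) - 1 := by
    have : (2 : ℝ) ≤ κ := by exact_mod_cast hκ
    linarith
  have hj1 : (1 : ℝ) ≤ j := by exact_mod_cast h1
  have hj2 : (j : ℝ) + 1 ≤ κ := by exact_mod_cast h2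
  have e : saddleAngle κ j = Real.pi * (((j : ℝ) - 1 / 2) / ((κ : ℝ) - 1)) := by
    rw [saddleAngle]; field_simp; ring
  rw [e]
  refine ⟨mul_pos Real.pi_pos (div_pos (by linarith) hk), ?_⟩
  exact mul_lt_of_lt_one_right Real.pi_pos ((div_lt_one hk).2 (by linarith))

theorem saddleAngle_injective (hκ : 2 ≤ κ) {i j : ℕ} (h : saddleAngle κ i = saddleAngle κ j) :
    i = j := by
  have hk : (0 : ℝ) < (κ : ℝ) - 1 := by
    have : (2 : ℝ) ≤ κ := by exact_mod_cast hκ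
    linarith
  have h1 : (i : ℝ) - 1 = (j : ℝ) - 1 :=
    mul_left_cancel₀ (div_pos Real.pi_pos hk).ne' (add_right_cancel h)
  exact_mod_cast sub_left_injective h1

theorem exp_saddleAngle_injective (hκ : 2 ≤ κ) {i j : ℕ} (hi1 : 1 ≤ i) (hi2 : i < κ)
    (hj1 : 1 ≤ j) (hj2 : j < κ)
    (h : Complex.exp (saddleAngle κ i * Complex.I) = Complex.exp (saddleAngle κ j * Complex.I)) :
    i = j := by
  have hi := saddleAngle_mem hκ hi1 hi2
  have hj := saddleAngle_mem hκ hj1 hj2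
  have := congrArg Complex.re h
  rw [Complex.exp_ofReal_mul_I_re, Complex.exp_ofReal_mul_I_re] at this
  exact saddleAngle_injective hκ
    (Real.injOn_cos (Set.Ioo_subset_Icc_self hi) (Set.Ioo_subset_Icc_self hj) this)

theorem exp_saddleAngle_ne_conj (hκ : 2 ≤ κ) {i j : ℕ} (hi1 : 1 ≤ i) (hi2 : i < κ)
    (hj1 : 1 ≤ j) (hj2 : j < κ) :
    Complex.exp (saddleAngle κ j * Complex.I)
      ≠ starRingEnd ℂ (Complex.exp (saddleAngle κ i * Complex.I)) := by
  intro h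
  have hi := Real.sin_pos_of_mem_Ioo (saddleAngle_mem hκ hi1 hi2)
  have hj := Real.sin_pos_of_mem_Ioo (saddleAngle_mem hκ hj1 hj2)
  have := congrArg Complex.im h
  rw [Complex.exp_ofReal_mul_I_im, Complex.conj_im, Complex.exp_ofReal_mul_I_im] at this
  linarith

theorem pow_neg_one_cases (j m : ℕ) :
    (-1 : ℂ) ^ j = (-1) ^ m ∨ (-1 : ℂ) ^ j = -(-1) ^ m := by
  rcases neg_one_pow_eq_or ℂ j with h | h <;> rcases neg_one_pow_eq_or ℂ m with h' | h' <;>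
    simp [h, h']

/-- A real point on the stable manifold of the `j`-th saddle is the zero of the real part of the
potential between the `j`-th and the `(j + 1)`-st root. -/
theorem inCell_of_mem_stableManifold (hκ : 2 ≤ κ) (hq : StrictAntiOn q (Set.Icc 1 κ)) {j : ℕ}
    (h1 : 1 ≤ j) (h2 : j < κ) {t : ℝ}
    (ht : (t : ℂ) ∈ stableManifold (signedField κ q j) (equatorSaddle κ j)) :
    InCell κ q j t ∧ (potential κ q t).re = 0 := by
  obtain ⟨ω, x, hx, hlim⟩ := ht
  change Tendsto _ (endFilter ω) _ at hlim
  rw [equatorSaddle_eq] at hlim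
  have hinf := norm_tendsto_atTop_of_poincareEmbedding hlim
  have h0 := potential_re_eq_zero_of_blowup hκ hq hx hinf
  have hcd := contDiff_signedField (κ := κ) (q := q) j
  have hroot : ∀ l ∈ Finset.Icc 1 κ, t ≠ q l := by
    intro l hl h
    have hmem : (0 : ℝ) ∈ forwardInterval ω := ⟨le_rfl, by exact_mod_cast hx.pos⟩
    have := signedField_ne_zero (hx.ne_zero_of_blowup hcd hinf hmem) l hl
    rw [hx.init, h, sub_self] at this
    exact this rfl
  obtain ⟨m, hm, hcell⟩ := exists_inCell hq hroot
  obtain ⟨hm1, hm2⟩ := cell_bounded_of_potential_re_eq_zero hκ hq hm hcell h0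
  have hp : t ∈ Set.Ioo (q (m + 1)) (q m) :=
    ⟨(hcell (m + 1) (by simp; omega)).2 (by omega), (hcell m (by simp; omega)).1 le_rfl⟩
  obtain ⟨X, hX0, hXd, -, hXl⟩ := exists_trajectory hκ hq hm1 hm2 hp h0 rfl
  have hX : IsForwardSolution (signedField κ q m) t _ X :=
    isForwardSolution_coe (mul_pos (residueSum_pos hq hm1 hm2) Real.pi_pos) hX0 hXd
  rw [← endFilter_coe, equatorSaddle_eq] at hXl
  rcases pow_neg_one_cases j m with h | h
  · have e : signedField κ q m = signedField κ q j := by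
      funext x; rw [signedField, signedField, h]
    rw [e] at hX
    have := exp_saddleAngle_injective hκ h1 h2 hm1 hm2 (hx.limit_unique hcd hX hlim hXl)
    subst this
    exact ⟨hcell, h0⟩
  -- For opposite parity, the reflected orbit solves the same equation from the same real point but
  -- ends on the lower half of the equator.
  · have hX' := hX.conj h
    rw [Complex.conj_ofReal] at hX'
    exact absurd (hx.limit_unique hcd hX' hlim (poincareEmbedding_conj_tendsto hXl))
      (exp_saddleAngle_ne_conj hκ hm1 hm2 h1 h2)

theorem imagField_polyQ {a : ℕ → ℝ} (hq : HasOrderedSimpleRoots κ (polyQ κ a) q) (x : ℂ) :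
    imagField (polyQ κ a) x = Complex.I * rootProd κ q x := by
  rw [imagField, polyQ_eq_neg_nodal hq, rootProd, Lagrange.nodal]
  simp [map_prod]

theorem signedField_of_odd {a : ℕ → ℝ} (hq : HasOrderedSimpleRoots κ (polyQ κ a) q) {j : ℕ}
    (hj : Odd j) : signedField κ q j = imagField (polyQ κ a) := by
  funext x
  rw [signedField, hj.neg_one_pow, imagField_polyQ hq, neg_neg, one_mul]

theorem trajH_eq {a : ℕ → ℝ} (hq : HasOrderedSimpleRoots κ (polyQ κ a) q) (j : ℕ) :
    trajH κ (polyQ κ a) j = stableManifold (signedField κ q j) (equatorSaddle κ j) := by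
  rw [trajH]
  split_ifs with hj
  · rw [signedField_of_odd hq hj]
  · rw [unstableManifold]
    congr 1
    funext x
    rw [signedField, (Nat.not_odd_iff_even.1 hj).neg_one_pow, imagField_polyQ hq, neg_mul, one_mul]

end Flow

end

/-! ### The main theorem -/

theorem mainTheorem2 (κ : ℕ) (hκ : 2 ≤ κ) (a q : ℕ → ℝ)
    (hq : HasOrderedSimpleRoots κ (polyQ κ a) q) :
    ∑ l ∈ Finset.Icc 1 κ, 1 / (polyQ κ a).derivative.eval (q l) = 0 ∧
    ∀ j ∈ Finset.Icc 1 (κ - 1),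
      ∃ p T : ℝ, trajH κ (polyQ κ a) j ∩ {x : ℂ | x.im = 0} = {(p : ℂ)} ∧
        0 < T ∧ IsBlowupTime (imagField (polyQ κ a)) (p : ℂ) T ∧
        ∑ l ∈ Finset.Icc 1 j, 1 / (polyQ κ a).derivative.eval (q l)
          = T * (-1) ^ j / Real.pi := by
  have hanti := hq.anti
  refine ⟨?_, fun j hj => ?_⟩
  · rw [Finset.sum_congr rfl fun l hl => one_div_derivative_polyQ hq hl]
    exact sum_residueAt hκ hanti
  rw [Finset.mem_Icc] at hj
  have h1 : 1 ≤ j := hj.1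
  have h2 : j < κ := by omega
  obtain ⟨p, hp, h0⟩ := exists_potential_re_eq_zero hκ hanti h1 h2
  set T : ℝ := (-1) ^ j * residueSum κ q j * Real.pi with hT
  have hTpos : 0 < T := mul_pos (residueSum_pos hanti h1 h2) Real.pi_pos
  obtain ⟨X, hX0, hXd, hXn, hXl⟩ := exists_trajectory hκ hanti h1 h2 hp h0 hT
  have hX : IsForwardSolution (signedField κ q j) p T X := isForwardSolution_coe hTpos hX0 hXd
  refine ⟨p, T, ?_, hTpos, ?_, ?_⟩
  · rw [trajH_eq hq]
    refine Set.Subset.antisymm ?_ ?_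
    · rintro z ⟨hz, hz0⟩
      have hzr : z = (z.re : ℂ) := Complex.ext (by simp) (by simpa using hz0)
      rw [hzr] at hz
      obtain ⟨hcell, h0'⟩ := inCell_of_mem_stableManifold hκ hanti h1 h2 hz
      have hre : z.re = p :=
        (strictAntiOn_potential_re hκ hanti h2.le).injOn hcell
          (inCell_of_mem_Ioo hanti h1 h2 hp) (by simp only [h0, h0'])
      rw [hzr, hre]
      rfl
    · rintro z rfl
      refine ⟨⟨T, X, hX, ?_⟩, Complex.ofReal_im p⟩
      change Tendsto _ (endFilter T) _
      rwa [endFilter_coe]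
  -- For even `j` the constructed orbit runs in reversed time; its conjugate is the forward solution
  -- from `p`, with the same blow-up time.
  · rcases Nat.even_or_odd j with hj' | hj'
    · have hodd : Odd (j + 1) := hj'.add_one
      have := hX.conj (j := j + 1) (by rw [pow_succ]; ring)
      rw [Complex.conj_ofReal, signedField_of_odd hq hodd] at this
      exact ⟨_, this, by simpa using hXn⟩
    · rw [← signedField_of_odd hq hj']
      exact ⟨X, hX, hXn⟩
  · have hsub : Finset.Icc 1 j ⊆ Finset.Icc 1 κ := Finset.Icc_subset_Icc_right h2.le
    rw [Finset.sum_congr rfl fun l hl => one_div_derivative_polyQ hq (hsub hl)]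
    have e : (-1 : ℝ) ^ j * (-1) ^ j = 1 := by rw [← mul_pow]; simp
    have hpi := Real.pi_ne_zero
    rw [eq_div_iff hpi, hT, residueSum]
    linear_combination (-(∑ l ∈ Finset.Icc 1 j, residueAt κ q l) * Real.pi) * e
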